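/- **Setting.** Pixels are points of $\mathbb Z^2$; two pixels are 4-adjacent (8-adjacent) if their $\ell^1$ (respectively $\ell^\infty$) distance is $1$. For a finite 4-connected set $T\subset\mathbb Z^2$, let $P_4(T)$ be the set of pixels outside $T$ that are 4-adjacent to a pixel of $T$. Let $G_4(T)$ be the graph on $\mathbb Z^2$ in which the pixels of $P_4(T)$ are black, all others are white, white pixels are joined when 4-adjacent and black pixels when 8-adjacent. Let $E_4(T)$ be the infinite white component of $G_4(T)$, and let $P_4^{ext}(T)$ be the subgraph of $G_4(T)$ induced by the pixels of $P_4(T)$ that are 4-adjacent to a pixel of $E_4(T)$. Drawn with straight edges in $\mathbb R^2$, it is a simple closed polygon; $V_4(T)$ is the open region bounded by this polygon. The *polygonal tile* of $T$ is $\mathscr P_4(T):=V_4(T)\setminus\bigcup_{\tau}V_4(\tau)$, where $\tau$ runs over all connected white subgraphs of $G_4(T)$ contained in $(V_4(T)\cap\mathbb Z^2)\setminus T$. The *diamond spiral* $\mathcal Q_k$ is the set of the first $k$ points of the clockwise spiral $(0,0),(0,1),(1,0),(0,-1),(-1,0),(-1,1),(0,2),(1,1),(2,0),(1,-1),(0,-2),\dots$,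 that is, of the sequence that starts at $(0,0)$ and in which $(x,y)$ is followed by $(x,y+1)$ if $y=0,\ x\le 0$; by $(x+1,y+1)$ if $y\ge1,\ x\le-1$; by $(x+1,y-1)$ if $y\ge 1,\ x\ge 0$; by $(x-1,y-1)$ if $y\le 0,\ x\ge1$; and by $(x-1,y+1)$ if $y\le-1,\ x\le0$. For integers $1\le\ell\le n$ with $n\ge2$, let $\mathcal D_{\ell,n}:=\{x\in\mathbb Z^2:\ -n<x_2-x_1<n,\ -n<x_2+x_1<2\ell-n+1\}$. Put $s_1(n):=n(2n-1)$ and $s_3(n):=n(2n+1)$. An open set $\mathcal F\subset\mathbb R^2$ *tiles the plane with respect to a lattice* $\mathcal L$ if $\bigcup_{y\in\mathcal L}(\overline{\mathcal F}+y)=\mathbb R^2$ and the translates $\mathcal F+y$, $y\in\mathcal L$, are pairwise disjoint. It *tiles the plane* if there is a set of isometries $g$ of the plane such that the sets $g(\overline{\mathcal F})$ cover $\mathbb R^2$ and the sets $g(\mathcal F)$ are pairwise disjoint. The lattice generated by a matrix is the one generated by its columns. **Lemma 7.2.** Let $n\ge 1$ be an integer. 1. If $k=s_1(n)+j$ with $j\in\{1,\dots,n\}$,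 then $\mathscr P_4(\mathcal Q_k)$ is open and tiles the plane with respect to the lattice generated by $\mathcal V_k:=\begin{pmatrix} n& n+j\\ -n-1& n-j\end{pmatrix}$. 2. If $k=s_3(n-1)+j$ with $j\in\{1,\dots,n\}$, then $\mathscr P_4(\mathcal Q_k)$ and $-\mathscr P_4(\mathcal Q_k)+(n,n)$ are disjoint, and their union is open and tiles the plane with respect to the lattice generated by $\mathcal W_k:=\begin{pmatrix} n-1& 2n-1+j\\ -n-1& 2n-1-j\end{pmatrix}$. 3. If $n\ge2$ and $1\le\ell\le n$, then $\mathscr P_4(\mathcal D_{\ell,n})$ is the interior of a convex hexagon, and it does not tile the plane (not even with rotated and reflected copies). -/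

import Mathlib

open Set

noncomputable section

namespace DigitalPlane

/-- The Euclidean plane. -/
abbrev Plane := EuclideanSpace ℝ (Fin 2)

/-- Pixels, i.e. points of the integer lattice. -/
abbrev Pixel := ℤ × ℤ

/-- The inclusion of the integer lattice in the plane. -/
def emb (z : Pixel) : Plane := !₂[(z.1 : ℝ), (z.2 : ℝ)]

/-- The `ℓ¹` metric on pixels; 4-adjacency is `d4 x y = 1`. -/
def d4 (x y : Pixel) : ℤ := |x.1 - y.1| + |x.2 - y.2|

/-- The `ℓ^∞` metric on pixels; 8-adjacency is `d8 x y = 1`. -/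
def d8 (x y : Pixel) : ℤ := max |x.1 - y.1| |x.2 - y.2|

/-- The site perimeter `P₄(T)`: pixels outside `T` that are 4-adjacent to `T`. -/
def sitePerim (T : Set Pixel) : Set Pixel := {z | z ∉ T ∧ ∃ t ∈ T, d4 z t = 1}

/-- The characteristic graph `G₄(T)`: colour the pixels of `P₄(T)` black and all other pixels white;
white pixels are joined when 4-adjacent, black pixels when 8-adjacent. -/
def charGraph (T : Set Pixel) : SimpleGraph Pixel where
  Adj x y := (x ∉ sitePerim T ∧ y ∉ sitePerim T ∧ d4 x y = 1) ∨
    (x ∈ sitePerim T ∧ y ∈ sitePerim T ∧ d8 x y = 1)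
  symm := by
    constructor
    intro x y h
    have h4 : d4 y x = d4 x y := by simp only [d4, abs_sub_comm]
    have h8 : d8 y x = d8 x y := by simp only [d8, abs_sub_comm]
    rw [h4, h8]
    tauto
  loopless := ⟨by intro x h; simp [d4, d8] at h⟩

/-- `E₄(T)`: the infinite white component of `G₄(T)`. -/
def exterior (T : Set Pixel) : Set Pixel :=
  {z | z ∉ sitePerim T ∧ {w | (charGraph T).Reachable z w}.Infinite}

/-- The exterior site perimeter `P₄^ext(T)`. -/
def extPerim (T : Set Pixel) : Set Pixel :=
  {z | z ∈ sitePerim T ∧ ∃ e ∈ exterior T, d4 z e = 1}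

/-- The graph induced by `G₄(T)` on `P₄^ext(T)`, drawn in the plane with straight edges. -/
def extCurve (T : Set Pixel) : Set Plane :=
  {x | ∃ p ∈ extPerim T, ∃ q ∈ extPerim T, (charGraph T).Adj p q ∧ x ∈ segment ℝ (emb p) (emb q)}

/-- `V₄(T)`: the open region bounded by the closed polygon `P₄^ext(T)`, i.e. the points off the
polygon whose connected component in the complement of the polygon is bounded. -/
def enclosed (T : Set Pixel) : Set Plane :=
  {x | x ∉ extCurve T ∧ Bornology.IsBounded (connectedComponentIn (extCurve T)ᶜ x)}

/-- The family `𝓜` of connected white subgraphs of `G₄(T)` contained in `Z₄(T) \ T`, where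
`Z₄(T)` is the set of lattice points of `V₄(T)`. -/
def enclosedWhite (T : Set Pixel) : Set (Set Pixel) :=
  {S | (∀ z ∈ S, emb z ∈ enclosed T ∧ z ∉ T ∧ z ∉ sitePerim T) ∧
    ((charGraph T).induce S).Connected}

/-- The polygonal tile `𝒫₄(T)`. -/
def polygonalTile (T : Set Pixel) : Set Plane :=
  enclosed T \ ⋃ S ∈ enclosedWhite T, enclosed S

/-- One step of the clockwise diamond spiral
`(0,0), (0,1), (1,0), (0,-1), (-1,0), (-1,1), (0,2), (1,1), (2,0), (1,-1), (0,-2), …`. -/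
def spiralStep (p : Pixel) : Pixel :=
  if p.2 = 0 ∧ p.1 ≤ 0 then (p.1, p.2 + 1)
  else if 1 ≤ p.2 ∧ p.1 ≤ -1 then (p.1 + 1, p.2 + 1)
  else if 1 ≤ p.2 then (p.1 + 1, p.2 - 1)
  else if 1 ≤ p.1 then (p.1 - 1, p.2 - 1)
  else (p.1 - 1, p.2 + 1)

/-- The diamond spiral `𝓠ₖ`: the first `k` points of the spiral from the origin. -/
def spiral (k : ℕ) : Set Pixel := {z | ∃ i < k, z = spiralStep^[i] (0, 0)}

/-- Sieben's component `𝓓_{ℓ,n}`. -/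
def sieben (l n : ℕ) : Set Pixel :=
  {x | -(n : ℤ) < x.2 - x.1 ∧ x.2 - x.1 < n ∧
    -(n : ℤ) < x.2 + x.1 ∧ x.2 + x.1 < 2 * (l : ℤ) - n + 1}

/-- `s₁(n) = n(2n-1)`. -/
def s₁ (n : ℕ) : ℕ := n * (2 * n - 1)

/-- `s₃(n) = n(2n+1)`. -/
def s₃ (n : ℕ) : ℕ := n * (2 * n + 1)

/-- The subgroup of the plane generated by the columns of an integer matrix. -/
def columnLattice (M : Matrix (Fin 2) (Fin 2) ℤ) : AddSubgroup Plane :=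
  AddSubgroup.closure (Set.range fun c : Fin 2 => emb (M 0 c, M 1 c))

/-- The open region `F` tiles the plane with respect to `L`: the translates of its closure by `L`
cover the plane, and distinct translates of `F` are disjoint. -/
def TilesByLattice (F : Set Plane) (L : AddSubgroup Plane) : Prop :=
  IsOpen F ∧ (⋃ y ∈ L, (fun x => x + y) '' closure F) = univ ∧
    ∀ y ∈ L, ∀ z ∈ L, y ≠ z → Disjoint ((fun x => x + y) '' F) ((fun x => x + z) '' F)

/-- The open region `F` tiles the plane by congruent copies (rotations, reflections and
translations are all allowed, in any number). -/
def TilesPlane (F : Set Plane) : Prop :=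
  ∃ S : Set (Plane ≃ᵢ Plane), (⋃ g ∈ S, g '' closure F) = univ ∧
    ∀ g ∈ S, ∀ h ∈ S, g ≠ h → Disjoint (g '' F) (h '' F)

/-- `F` is the interior of a convex hexagon: of the convex hull of six points none of which is in
the convex hull of the other five. -/
def IsOpenConvexHexagon (F : Set Plane) : Prop :=
  ∃ v : Fin 6 → Plane, ConvexIndependent ℝ v ∧ F = interior (convexHull ℝ (Set.range v))

/-- The half turn `x ↦ -x + a` of the set `F`. -/
def halfTurn (a : Pixel) (F : Set Plane) : Set Plane := (fun x => -x + emb a) '' F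

end DigitalPlane

end

open DigitalPlane

/-!
For every set `T` in question, `P₄ᵉˣᵗ(T)` traces the boundary of an explicit bounded open set `U`
all of whose pixels belong to `T` and which is a union of two convex polygons (possibly equal). A
point off the closure of such a `U` can be joined to infinity by a ray avoiding it, so `V₄(T) = U`,
and nothing is removed from it: the polygonal tile is `U`.

In the coordinates `v = y - x` and `u = x + y`, the fundamental domains of the first two parts lie
over one period `H` of `v`, between the graphs of a monotone function `L` with `L (v + H) = L v + c`
and of `v ↦ L (v + s) + W`. Translation by `(H, c)` extends the domain to the strip between the full
graphs, and the translates of the strip by multiples of `(-s, W)` fill the plane.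

The hexagon has right angles at two adjacent vertices and angles `3π/4` at the other four. In a
tiling the angles around each point add up to `2π`, so three obtuse angles never meet; nor does an
obtuse vertex lie inside a side of another tile, since the remaining `π/4` could not be filled. The
two unit sides join obtuse vertices and are the shortest sides, so across each of them lies a unit
side of a neighbour. This puts a second obtuse angle at either end of the side of length
`(n - 1)√2` between the unit sides. The tile across that side has a side contained in it, whose
ends can only be right angles; but the side with right angles at its ends has length `n√2`.
-/

namespace DigitalPlane

section Coordinates

theorem emb_apply_zero (z : Pixel) : emb z 0 = z.1 := by simp [emb]

theorem emb_apply_one (z : Pixel) : emb z 1 = z.2 := by simp [emb]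

theorem plane_ext {x y : Plane} (h0 : x 0 = y 0) (h1 : x 1 = y 1) : x = y := by
  ext i
  fin_cases i
  exacts [h0, h1]

theorem emb_ne_zero {z : Pixel} (hz : z ≠ 0) : emb z ≠ 0 := fun h => hz <| by
  have h₀ := congrFun (congrArg WithLp.ofLp h) 0
  have h₁ := congrFun (congrArg WithLp.ofLp h) 1
  simp only [emb_apply_zero, emb_apply_one, PiLp.zero_apply, Int.cast_eq_zero] at h₀ h₁
  exact Prod.ext h₀ h₁

theorem emb_sub (z w : Pixel) : emb (z - w) = emb z - emb w :=
  plane_ext (by simp [emb]) (by simp [emb])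

theorem inner_emb (z : Pixel) (p : Plane) : inner ℝ (emb z) p = z.1 * p 0 + z.2 * p 1 := by
  simp [PiLp.inner_apply, Fin.sum_univ_two, emb, mul_comm]

theorem inner_emb_emb (z w : Pixel) :
    inner ℝ (emb z) (emb w) = ((z.1 * w.1 + z.2 * w.2 : ℤ) : ℝ) := by
  rw [inner_emb, emb_apply_zero, emb_apply_one]
  push_cast
  rfl

theorem isBounded_of_abs_apply_le {R : Set Plane} (C : ℝ) (h : ∀ p ∈ R, |p 0| ≤ C ∧ |p 1| ≤ C) :
    Bornology.IsBounded R := by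
  have hcube : Bornology.IsBounded (WithLp.ofLp '' R) := by
    refine (Metric.isBounded_Icc (fun _ : Fin 2 => -C) fun _ => C).subset ?_
    rintro _ ⟨p, hp, rfl⟩
    simp only [mem_Icc, Pi.le_def, Fin.forall_fin_two]
    exact ⟨⟨(abs_le.1 (h p hp).1).1, (abs_le.1 (h p hp).2).1⟩,
      (abs_le.1 (h p hp).1).2, (abs_le.1 (h p hp).2).2⟩
  exact ((PiLp.antilipschitzWith_ofLp 2 fun _ : Fin 2 => ℝ).isBounded_preimage hcube).subset
    (subset_preimage_image _ _)

end Coordinates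

section Polygons

variable {ι κ : Type*} {ν : ι → Pixel} {c : ι → ℤ} {ν' : κ → Pixel} {c' : κ → ℤ}

/-- The intersection of the open half-planes `⟪ν i, p⟫ < c i`, given by integral normals `ν i` and
offsets `c i`. -/
def openPolygon (ν : ι → Pixel) (c : ι → ℤ) : Set Plane :=
  {p | ∀ i, inner ℝ (emb (ν i)) p < c i}

/-- The intersection of the closed half-planes `⟪ν i, p⟫ ≤ c i`. -/
def closedPolygon (ν : ι → Pixel) (c : ι → ℤ) : Set Plane :=
  {p | ∀ i, inner ℝ (emb (ν i)) p ≤ c i}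

theorem mem_openPolygon {p : Plane} :
    p ∈ openPolygon ν c ↔ ∀ i, (ν i).1 * p 0 + (ν i).2 * p 1 < c i := by
  simp only [openPolygon, mem_ofPred_eq, inner_emb]

theorem mem_closedPolygon {p : Plane} :
    p ∈ closedPolygon ν c ↔ ∀ i, (ν i).1 * p 0 + (ν i).2 * p 1 ≤ c i := by
  simp only [closedPolygon, mem_ofPred_eq, inner_emb]

theorem emb_mem_openPolygon {z : Pixel} :
    emb z ∈ openPolygon ν c ↔ ∀ i, (ν i).1 * z.1 + (ν i).2 * z.2 < c i := by
  simp only [mem_openPolygon, emb_apply_zero, emb_apply_one]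
  norm_cast

theorem emb_mem_closedPolygon {z : Pixel} :
    emb z ∈ closedPolygon ν c ↔ ∀ i, (ν i).1 * z.1 + (ν i).2 * z.2 ≤ c i := by
  simp only [mem_closedPolygon, emb_apply_zero, emb_apply_one]
  norm_cast

theorem isOpen_openPolygon [Finite ι] : IsOpen (openPolygon ν c) := by
  simp only [openPolygon, ofPred_forall]
  exact isOpen_iInter_of_finite fun i => isOpen_lt (by fun_prop) continuous_const

theorem isClosed_closedPolygon : IsClosed (closedPolygon ν c) := by
  simp only [closedPolygon, ofPred_forall]
  exact isClosed_iInter fun i => isClosed_le (by fun_prop) continuous_const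

theorem convex_openPolygon : Convex ℝ (openPolygon ν c) := by
  simp only [openPolygon, ofPred_forall]
  exact convex_iInter fun i => convex_halfSpace_lt (innerSL ℝ (emb (ν i))).toLinearMap.isLinear _

theorem convex_closedPolygon : Convex ℝ (closedPolygon ν c) := by
  simp only [closedPolygon, ofPred_forall]
  exact convex_iInter fun i => convex_halfSpace_le (innerSL ℝ (emb (ν i))).toLinearMap.isLinear _

theorem openPolygon_subset_closedPolygon : openPolygon ν c ⊆ closedPolygon ν c :=
  fun _ hp i => (hp i).le

theorem closure_openPolygon (h : (openPolygon ν c).Nonempty) :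
    closure (openPolygon ν c) = closedPolygon ν c := by
  refine Subset.antisymm
    (closure_minimal openPolygon_subset_closedPolygon isClosed_closedPolygon) fun x hx => ?_
  obtain ⟨y, hy⟩ := h
  have hxy : openSegment ℝ x y ⊆ openPolygon ν c := by
    rintro _ ⟨a, b, ha, hb, hab, rfl⟩ i
    rw [inner_add_right, inner_smul_right, inner_smul_right]
    calc a * inner ℝ (emb (ν i)) x + b * inner ℝ (emb (ν i)) y
        < a * c i + b * c i :=
          add_lt_add_of_le_of_lt (mul_le_mul_of_nonneg_left (hx i) ha.le)
            (mul_lt_mul_of_pos_left (hy i) hb)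
      _ = c i := by rw [← add_mul, hab, one_mul]
  exact closure_mono hxy (segment_subset_closure_openSegment (left_mem_segment ℝ x y))

theorem disjoint_segment_openPolygon {z w : Pixel} (i : ι)
    (hz : c i ≤ (ν i).1 * z.1 + (ν i).2 * z.2) (hw : c i ≤ (ν i).1 * w.1 + (ν i).2 * w.2) :
    Disjoint (segment ℝ (emb z) (emb w)) (openPolygon ν c) := by
  have hmem {z : Pixel} (hz : c i ≤ (ν i).1 * z.1 + (ν i).2 * z.2) :
      emb z ∈ {p | (c i : ℝ) ≤ innerSL ℝ (emb (ν i)) p} := by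
    simp only [mem_ofPred_eq, innerSL_apply_apply, inner_emb, emb_apply_zero, emb_apply_one]
    exact_mod_cast hz
  have hconv := convex_halfSpace_ge (innerSL ℝ (emb (ν i))).toLinearMap.isLinear (c i : ℝ)
  exact disjoint_left.2 fun x hx hx' =>
    (hx' i).not_ge (hconv.segment_subset (hmem hz) (hmem hw) hx)

end Polygons

section CharacteristicGraph

variable {T : Set Pixel}

theorem d4_eq_one_iff (x y : Pixel) : d4 x y = 1 ↔
    (x.1 = y.1 + 1 ∧ x.2 = y.2) ∨ (x.1 = y.1 - 1 ∧ x.2 = y.2) ∨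
    (x.1 = y.1 ∧ x.2 = y.2 + 1) ∨ (x.1 = y.1 ∧ x.2 = y.2 - 1) := by
  unfold d4
  rcases abs_cases (x.1 - y.1) with h | h <;> rcases abs_cases (x.2 - y.2) with h' | h' <;> omega

theorem d8_eq_one_iff (x y : Pixel) : d8 x y = 1 ↔
    ¬(x.1 = y.1 ∧ x.2 = y.2) ∧ |y.1 - x.1| ≤ 1 ∧ |y.2 - x.2| ≤ 1 := by
  rw [d8, abs_sub_comm x.1, abs_sub_comm x.2]
  grind

theorem d4_self_add (z d : Pixel) : d4 z (z + d) = d4 d 0 := by simp [d4]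

theorem d8_self_add (z d : Pixel) : d8 z (z + d) = d8 d 0 := by simp [d8]

theorem mem_sitePerim_iff (a b : ℤ) : (a, b) ∈ sitePerim T ↔
    (a, b) ∉ T ∧ ((a + 1, b) ∈ T ∨ (a - 1, b) ∈ T ∨ (a, b + 1) ∈ T ∨ (a, b - 1) ∈ T) := by
  refine and_congr_right fun _ => ⟨?_, ?_⟩
  · rintro ⟨⟨c, d⟩, ht, hd⟩
    simp only [d4_eq_one_iff] at hd
    rcases hd with ⟨rfl, rfl⟩ | ⟨rfl, rfl⟩ | ⟨rfl, rfl⟩ | ⟨rfl, rfl⟩ <;> simp [ht]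
  · rintro (h | h | h | h) <;> exact ⟨_, h, by simp [d4]⟩

theorem mem_exterior_of_ray {z d : Pixel} (hd : d4 d 0 = 1)
    (h : ∀ k : ℕ, z + k • d ∉ sitePerim T) : z ∈ exterior T := by
  have hreach (k : ℕ) : (charGraph T).Reachable z (z + k • d) := by
    induction k with
    | zero => simp
    | succ k ih =>
      refine ih.trans (SimpleGraph.Adj.reachable (Or.inl ⟨h k, h (k + 1), ?_⟩))
      rw [succ_nsmul, ← add_assoc, d4_self_add, hd]
  have hd0 : d ≠ 0 := by
    rintro rfl
    simp [d4] at hd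
  have hinj : Function.Injective fun k : ℕ => z + k • d := fun a b hab =>
    Nat.cast_injective (smul_left_injective ℤ hd0 (by simpa using hab))
  exact ⟨by simpa using h 0, infinite_of_injective_forall_mem hinj hreach⟩

theorem extPerim_eq_sitePerim
    (h : ∀ z ∈ sitePerim T, ∃ d : Pixel, d4 d 0 = 1 ∧
      ∀ k : ℤ, 0 < k → (z.1 + k * d.1, z.2 + k * d.2) ∉ sitePerim T) :
    extPerim T = sitePerim T := by
  refine Subset.antisymm (fun z hz => hz.1) fun z hz => ⟨hz, ?_⟩
  obtain ⟨d, hd, hray⟩ := h z hz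
  refine ⟨z + d, mem_exterior_of_ray hd fun k => ?_, ?_⟩
  · rw [add_assoc, ← succ_nsmul']
    simpa [Prod.add_def] using hray (k + 1) (by omega)
  · rw [d4_self_add, hd]

end CharacteristicGraph

theorem exists_ray_notMem_of_convex {E : Type*} [NormedAddCommGroup E] [NormedSpace ℝ E]
    (hE : 1 < Module.finrank ℝ E) {A B : Set E} (hA : Convex ℝ A) (hAc : IsClosed A)
    (hB : Convex ℝ B) (hBc : IsClosed B) {x : E} (hxA : x ∉ A) (hxB : x ∉ B) :
    ∃ d : E, d ≠ 0 ∧ ∀ t : ℝ, 0 ≤ t → x + t • d ∉ A ∪ B := by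
  have : FiniteDimensional ℝ E := Module.finite_of_finrank_pos (by omega)
  obtain ⟨f, u, hfA, hfx⟩ := geometric_hahn_banach_closed_point hA hAc hxA
  obtain ⟨g, v, hgB, hgx⟩ := geometric_hahn_banach_closed_point hB hBc hxB
  obtain ⟨d, hd, hd0⟩ := Submodule.exists_mem_ne_zero_of_ne_bot
    (LinearMap.ker_ne_bot_of_finrank_lt (f := f.toLinearMap) (by simpa using hE))
  have hfd : f d = 0 := hd
  -- Moving along a direction in the kernel of `f` never enters `A`, and one of its two orientations
  -- does not decrease `g`.
  obtain ⟨e, he0, hfe, hge⟩ : ∃ e : E, e ≠ 0 ∧ f e = 0 ∧ 0 ≤ g e := by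
    rcases le_total 0 (g d) with h | h
    · exact ⟨d, hd0, hfd, h⟩
    · exact ⟨-d, neg_ne_zero.2 hd0, by rw [map_neg, hfd, neg_zero], by rw [map_neg]; linarith⟩
  refine ⟨e, he0, fun t ht => ?_⟩
  rintro (hmem | hmem)
  · have := hfA _ hmem
    rw [map_add, map_smul, hfe, smul_zero, add_zero] at this
    exact this.not_gt hfx
  · have := hgB _ hmem
    rw [map_add, map_smul, smul_eq_mul] at this
    linarith [mul_nonneg ht hge]

section EnclosedRegion

variable {T : Set Pixel} {R : Set Plane}

theorem enclosed_eq (hR : IsOpen R) (hb : Bornology.IsBounded R) (hcurve : extCurve T = frontier R)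
    (hout : ∀ x ∉ closure R, ∃ d : Plane, d ≠ 0 ∧ ∀ t : ℝ, 0 ≤ t → x + t • d ∉ closure R) :
    enclosed T = R := by
  have hcompl : (extCurve T)ᶜ = R ∪ (closure R)ᶜ := by
    rw [hcurve, frontier, hR.interior_eq, sdiff_eq, compl_inter, compl_compl, union_comm]
  refine Subset.antisymm ?_ fun x hx => ⟨?_, hb.subset ?_⟩
  · rintro x ⟨hx, hbd⟩
    by_contra hxR
    have hxc : x ∉ closure R := fun hc => hx (hcurve ▸ ⟨hc, hR.interior_eq.symm ▸ hxR⟩)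
    obtain ⟨d, hd, hray⟩ := hout x hxc
    have hsub : (fun t : ℝ => x + t • d) '' Ici 0 ⊆ connectedComponentIn (extCurve T)ᶜ x := by
      refine (isPreconnected_Ici.image _ (by fun_prop)).subset_connectedComponentIn
        ⟨0, self_mem_Ici, by simp⟩ ?_
      rintro _ ⟨t, ht, rfl⟩
      exact hcompl ▸ Or.inr (hray t ht)
    obtain ⟨r, hr, hball⟩ := (hbd.subset hsub).subset_closedBall_lt 0 x
    have hd' : 0 < ‖d‖ := norm_pos_iff.2 hd
    have ht : 0 ≤ (r + 1) / ‖d‖ := by positivity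
    have hdist := hball ⟨(r + 1) / ‖d‖, ht, rfl⟩
    rw [Metric.mem_closedBall, dist_self_add_left, norm_smul, Real.norm_of_nonneg ht,
      div_mul_cancel₀ _ hd'.ne'] at hdist
    linarith
  · exact fun h => (hcurve ▸ h : x ∈ frontier R).2 (hR.interior_eq.symm ▸ hx)
  · exact isPreconnected_connectedComponentIn.subset_left_of_subset_union hR
      isClosed_closure.isOpen_compl (disjoint_compl_right.mono_left subset_closure)
      (hcompl ▸ connectedComponentIn_subset _ _)
      ⟨x, mem_connectedComponentIn (hcompl ▸ Or.inl hx), hx⟩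

theorem polygonalTile_eq_enclosed (h : ∀ z, emb z ∈ enclosed T → z ∈ T) :
    polygonalTile T = enclosed T := by
  have hempty : enclosedWhite T = ∅ := by
    refine eq_empty_of_forall_notMem fun S ⟨hS, hconn⟩ => ?_
    obtain ⟨z⟩ := hconn.nonempty
    exact (hS z z.2).2.1 (h z (hS z z.2).1)
  simp only [polygonalTile, hempty, mem_empty_iff_false, iUnion_of_empty, iUnion_empty, sdiff_empty]

theorem polygonalTile_eq_of_convex_union {A B : Set Plane} (hA : Convex ℝ A) (hB : Convex ℝ B)
    (hAo : IsOpen A) (hBo : IsOpen B) (hbdd : Bornology.IsBounded (A ∪ B))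
    (hcurve : extCurve T = frontier (A ∪ B)) (hpix : ∀ z, emb z ∈ A ∪ B → z ∈ T) :
    polygonalTile T = A ∪ B := by
  have he : enclosed T = A ∪ B := by
    refine enclosed_eq (hAo.union hBo) hbdd hcurve fun x hx => ?_
    rw [closure_union] at hx ⊢
    exact exists_ray_notMem_of_convex (by simp) hA.closure isClosed_closure
      hB.closure isClosed_closure (fun h => hx (Or.inl h)) fun h => hx (Or.inr h)
  rw [polygonalTile_eq_enclosed fun z hz => hpix z (he ▸ hz), he]

theorem mem_extCurve_of_run (hT : extPerim T = sitePerim T) {p d : Pixel} (hd : d8 d 0 = 1) {m : ℤ}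
    (hm : 1 ≤ m) (hrun : ∀ i : ℤ, 0 ≤ i → i ≤ m → (p.1 + i * d.1, p.2 + i * d.2) ∈ sitePerim T)
    {x : Plane} (s : ℝ) (hs : 0 ≤ s) (hsm : s ≤ m) (h0 : x 0 = p.1 + s * d.1)
    (h1 : x 1 = p.2 + s * d.2) :
    x ∈ extCurve T := by
  set i : ℤ := min ⌊s⌋ (m - 1) with hi
  have hi0 : 0 ≤ i := le_min (Int.floor_nonneg.2 hs) (by omega)
  have him : i + 1 ≤ m := by omega
  have his : (i : ℝ) ≤ s := (Int.cast_le.2 (min_le_left _ _)).trans (Int.floor_le s)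
  have his' : s ≤ i + 1 := by
    rcases min_choice ⌊s⌋ (m - 1) with h | h <;> rw [hi, h]
    · exact (Int.lt_floor_add_one s).le
    · push_cast
      linarith
  have hp := hrun i hi0 (by omega)
  have hq := hrun (i + 1) (by omega) him
  refine ⟨_, hT ▸ hp, _, hT ▸ hq, Or.inr ⟨hp, hq, ?_⟩, ?_⟩
  · simpa only [Prod.add_def, add_mul, one_mul, add_assoc, hd] using
      d8_self_add (p.1 + i * d.1, p.2 + i * d.2) d
  · rw [segment_eq_image']
    refine ⟨s - i, ⟨by linarith, by linarith⟩, plane_ext ?_ ?_⟩ <;> simp [emb, h0, h1] <;> ring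

theorem extCurve_subset {C : Set Plane} (h : ∀ p ∈ sitePerim T, ∀ q ∈ sitePerim T, d8 p q = 1 →
    segment ℝ (emb p) (emb q) ⊆ C) : extCurve T ⊆ C := by
  rintro x ⟨p, ⟨hp, -⟩, q, ⟨hq, -⟩, hadj, hx⟩
  rcases hadj with ⟨hp', -⟩ | ⟨-, -, hpq⟩
  · exact absurd hp hp'
  · exact h p hp q hq hpq hx

theorem extCurve_subset_frontier_union_openPolygon {ι κ : Type*} [Finite ι] [Finite κ]
    {ν : ι → Pixel} {c : ι → ℤ} {ν' : κ → Pixel} {c' : κ → ℤ} (hne : (openPolygon ν c).Nonempty)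
    (hne' : (openPolygon ν' c').Nonempty)
    (h : ∀ p ∈ sitePerim T, ∀ q ∈ sitePerim T, d8 p q = 1 →
      ((emb p ∈ closedPolygon ν c ∧ emb q ∈ closedPolygon ν c) ∨
        (emb p ∈ closedPolygon ν' c' ∧ emb q ∈ closedPolygon ν' c')) ∧
      (∃ i, c i ≤ (ν i).1 * p.1 + (ν i).2 * p.2 ∧ c i ≤ (ν i).1 * q.1 + (ν i).2 * q.2) ∧
      ∃ i, c' i ≤ (ν' i).1 * p.1 + (ν' i).2 * p.2 ∧ c' i ≤ (ν' i).1 * q.1 + (ν' i).2 * q.2) :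
    extCurve T ⊆ frontier (openPolygon ν c ∪ openPolygon ν' c') := by
  rw [frontier, (isOpen_openPolygon.union isOpen_openPolygon).interior_eq, closure_union,
    closure_openPolygon hne, closure_openPolygon hne']
  refine extCurve_subset fun p hp q hq hpq x hx => ?_
  obtain ⟨hclosed, ⟨i, hpi, hqi⟩, k, hpk, hqk⟩ := h p hp q hq hpq
  refine ⟨?_, not_or.2 ⟨disjoint_left.1 (disjoint_segment_openPolygon i hpi hqi) hx,
    disjoint_left.1 (disjoint_segment_openPolygon k hpk hqk) hx⟩⟩
  exact hclosed.imp (fun hpq => convex_closedPolygon.segment_subset hpq.1 hpq.2 hx)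
    fun hpq => convex_closedPolygon.segment_subset hpq.1 hpq.2 hx

end EnclosedRegion

section Spiral

/-- After `k` steps the diamond spiral is about to visit `p`, having visited exactly the pixels
of `A`. -/
def AtSpiral (k : ℕ) (p : Pixel) (A : Set Pixel) : Prop :=
  spiralStep^[k] (0, 0) = p ∧ spiral k = A

theorem AtSpiral.succ {k : ℕ} {p : Pixel} {A : Set Pixel} (h : AtSpiral k p A) :
    AtSpiral (k + 1) (spiralStep p) (A ∪ {p}) := by
  obtain ⟨hp, rfl⟩ := h
  refine ⟨by rw [Function.iterate_succ_apply', hp], ?_⟩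
  ext z
  simp only [spiral, mem_ofPred_eq, mem_union, mem_singleton_iff, Nat.lt_succ_iff_lt_or_eq,
    or_and_right, exists_or, exists_eq_left, hp]

theorem AtSpiral.run {k m : ℕ} {q : ℕ → Pixel} {A : ℕ → Set Pixel} (h : AtSpiral k (q 0) (A 0))
    (hq : ∀ i < m, spiralStep (q i) = q (i + 1)) (hA : ∀ i < m, A i ∪ {q i} = A (i + 1)) :
    ∀ i ≤ m, AtSpiral (k + i) (q i) (A i) := by
  intro i
  induction i with
  | zero => exact fun _ => h
  | succ i ih =>
    intro hi
    rw [← hq i hi, ← hA i hi]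
    exact (ih (by omega)).succ

/-- The pixels visited after `s₁ n + j` steps, while the spiral descends along `x + y = n`. -/
def northEastStage (n j : ℤ) : Set Pixel :=
  {z | -n < z.1 + z.2 ∧ -n < z.2 - z.1 ∧ z.2 - z.1 < n + 1 ∧
    (z.1 + z.2 < n ∨ (z.1 + z.2 < n + 1 ∧ z.1 < j))}

/-- The pixels visited after `s₁ n + n + j` steps, while the spiral descends along
`y - x = -n`. -/
def southEastStage (n j : ℤ) : Set Pixel :=
  {z | -n < z.1 + z.2 ∧ z.1 + z.2 < n + 1 ∧ z.2 - z.1 < n + 1 ∧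
    (-n < z.2 - z.1 ∨ (-n - 1 < z.2 - z.1 ∧ n - j < z.1))}

/-- The pixels visited after `s₃ n + j` steps, while the spiral ascends along `x + y = -n`. -/
def southWestStage (n j : ℤ) : Set Pixel :=
  {z | z.1 + z.2 < n + 1 ∧ -n - 1 < z.2 - z.1 ∧ z.2 - z.1 < n + 1 ∧
    (-n < z.1 + z.2 ∨ (-n - 1 < z.1 + z.2 ∧ -j < z.1))}

/-- The pixels visited after `s₃ n + n + 1 + j` steps, while the spiral ascends along
`y - x = n + 1`. -/
def northWestStage (n j : ℤ) : Set Pixel :=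
  {z | -n - 1 < z.1 + z.2 ∧ z.1 + z.2 < n + 1 ∧ -n - 1 < z.2 - z.1 ∧
    (z.2 - z.1 < n + 1 ∨ (z.2 - z.1 < n + 2 ∧ z.1 < -n + j))}

theorem northEastStage_self (n : ℕ) : northEastStage n n = southEastStage n 0 := by
  ext z
  simp only [northEastStage, southEastStage, mem_ofPred_eq]
  omega

theorem southEastStage_self (n : ℕ) : southEastStage n n = southWestStage n 0 := by
  ext z
  simp only [southEastStage, southWestStage, mem_ofPred_eq]
  omega

theorem southWestStage_succ (n : ℕ) : southWestStage n (n + 1) = northWestStage n 0 := by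
  ext z
  simp only [southWestStage, northWestStage, mem_ofPred_eq]
  omega

theorem northWestStage_self (n : ℕ) : northWestStage n n = northEastStage (n + 1) 0 := by
  ext z
  simp only [northWestStage, northEastStage, mem_ofPred_eq]
  omega

theorem AtSpiral.northEast {k n : ℕ} (h : AtSpiral k (0, n) (northEastStage n 0)) :
    ∀ i ≤ n, AtSpiral (k + i) (i, n - i) (northEastStage n i) := by
  refine AtSpiral.run (q := fun i => ((i : ℤ), (n : ℤ) - i)) (A := fun i => northEastStage n i)
    (by simpa using h) (fun i hi => ?_) fun i hi => ?_
  · simp only [spiralStep, Prod.ext_iff]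
    split_ifs <;> omega
  · ext z
    simp only [northEastStage, mem_ofPred_eq, mem_union, mem_singleton_iff, Prod.ext_iff]
    omega

theorem AtSpiral.southEast {k n : ℕ} (h : AtSpiral k (n, 0) (southEastStage n 0)) :
    ∀ i ≤ n, AtSpiral (k + i) (n - i, -i) (southEastStage n i) := by
  refine AtSpiral.run (q := fun i => ((n : ℤ) - i, -(i : ℤ))) (A := fun i => southEastStage n i)
    (by simpa using h) (fun i hi => ?_) fun i hi => ?_
  · simp only [spiralStep, Prod.ext_iff]
    split_ifs <;> omega
  · ext z
    simp only [southEastStage, mem_ofPred_eq, mem_union, mem_singleton_iff, Prod.ext_iff]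
    omega

theorem southWestStage_union_singleton {n i : ℕ} (hi : i ≤ n) :
    southWestStage n i ∪ {(-(i : ℤ), -(n : ℤ) + i)} = southWestStage n (i + 1) := by
  ext z
  simp only [southWestStage, mem_ofPred_eq, mem_union, mem_singleton_iff, Prod.ext_iff]
  omega

theorem AtSpiral.southWest {k n : ℕ} (h : AtSpiral k (0, -n) (southWestStage n 0)) :
    ∀ i ≤ n, AtSpiral (k + i) (-i, -n + i) (southWestStage n i) := by
  refine AtSpiral.run (q := fun i => (-(i : ℤ), -(n : ℤ) + i)) (A := fun i => southWestStage n i)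
    (by simpa using h) (fun i hi => ?_)
    fun i hi => by simpa using southWestStage_union_singleton hi.le
  simp only [spiralStep, Prod.ext_iff]
  split_ifs <;> omega

theorem AtSpiral.southWest_succ {k n : ℕ} (h : AtSpiral k (0, -n) (southWestStage n 0)) :
    AtSpiral (k + n + 1) (-n, 1) (southWestStage n (n + 1)) := by
  have hlast := (h.southWest n le_rfl).succ
  have hstep : spiralStep (-(n : ℤ), -(n : ℤ) + n) = (-(n : ℤ), 1) := by simp [spiralStep]
  rwa [southWestStage_union_singleton le_rfl, hstep] at hlast

theorem AtSpiral.northWest {k n : ℕ} (h : AtSpiral k (-n, 1) (northWestStage n 0)) :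
    ∀ i ≤ n, AtSpiral (k + i) (-n + i, 1 + i) (northWestStage n i) := by
  refine AtSpiral.run (q := fun i => (-(n : ℤ) + i, 1 + (i : ℤ)))
    (A := fun i => northWestStage n i) (by simpa using h) (fun i hi => ?_) fun i hi => ?_
  · simp only [spiralStep, Prod.ext_iff]
    split_ifs <;> omega
  · ext z
    simp only [northWestStage, mem_ofPred_eq, mem_union, mem_singleton_iff, Prod.ext_iff]
    omega

theorem s₃_succ (n : ℕ) : s₃ (n + 1) = s₁ (n + 1) + (n + 1) + (n + 1) := by
  simp only [s₁, s₃, show 2 * (n + 1) - 1 = 2 * n + 1 by omega]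
  ring

theorem s₁_succ (n : ℕ) : s₁ (n + 1) = s₃ n + n + 1 + n := by
  simp only [s₁, s₃, show 2 * (n + 1) - 1 = 2 * n + 1 by omega]
  ring

theorem atSpiral_s₁_succ_of_s₃ {n : ℕ} (h : AtSpiral (s₃ n) (0, -n) (southWestStage n 0)) :
    AtSpiral (s₁ (n + 1)) (0, (n + 1 : ℕ)) (northEastStage (n + 1 : ℕ) 0) := by
  have h' := AtSpiral.northWest (southWestStage_succ n ▸ h.southWest_succ) n le_rfl
  rw [← s₁_succ, northWestStage_self, neg_add_cancel, add_comm 1] at h'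
  exact_mod_cast h'

theorem atSpiral_s₃_of_s₁ {n : ℕ}
    (h : AtSpiral (s₁ (n + 1)) (0, (n + 1 : ℕ)) (northEastStage (n + 1 : ℕ) 0)) :
    AtSpiral (s₃ (n + 1)) (0, -(n + 1 : ℕ)) (southWestStage (n + 1 : ℕ) 0) := by
  have h' := h.northEast (n + 1) le_rfl
  rw [northEastStage_self, sub_self] at h'
  have h'' := h'.southEast (n + 1) le_rfl
  rwa [← s₃_succ, southEastStage_self, sub_self] at h''

theorem atSpiral_s₃ (n : ℕ) : AtSpiral (s₃ n) (0, -n) (southWestStage n 0) := by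
  induction n with
  | zero =>
    refine ⟨rfl, eq_empty_of_forall_notMem ?_ |>.trans (eq_empty_of_forall_notMem ?_).symm⟩
    · rintro z ⟨i, hi, -⟩
      simp [s₃] at hi
    · intro z
      simp only [southWestStage, mem_ofPred_eq]
      omega
  | succ n ih => exact atSpiral_s₃_of_s₁ (atSpiral_s₁_succ_of_s₃ ih)

theorem spiral_s₁_add {n j : ℕ} (hn : n ≠ 0) (hj : j ≤ n) :
    spiral (s₁ n + j) = northEastStage n j := by
  obtain ⟨m, rfl⟩ := Nat.exists_eq_succ_of_ne_zero hn
  exact ((atSpiral_s₁_succ_of_s₃ (atSpiral_s₃ m)).northEast j hj).2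

theorem spiral_s₃_add {n j : ℕ} (hj : j ≤ n + 1) : spiral (s₃ n + j) = southWestStage n j := by
  rcases hj.lt_or_eq with h | rfl
  · exact ((atSpiral_s₃ n).southWest j (by omega)).2
  · exact_mod_cast (atSpiral_s₃ n).southWest_succ.2

end Spiral

section NorthEastTile

/-- The polygonal tile of the spiral after `s₁ n + j` steps: a rectangle with a truncated corner,
with a strip of width one added along part of its north-east side. -/
def northEastTile (n j : ℤ) : Set Plane :=
  openPolygon ![(-1, -1), (1, -1), (-1, 1), (-1, 0), (1, 1)] ![n, n, n + 1, n, n] ∪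
    openPolygon ![(-1, -1), (1, -1), (-1, 1), (-1, 0), (1, 1), (1, 0)] ![n, n, n + 1, n, n + 1, j]

theorem mem_northEastTile {n j : ℤ} {p : Plane} : p ∈ northEastTile n j ↔
    -(n : ℝ) < p 0 + p 1 ∧ -(n : ℝ) < p 1 - p 0 ∧ p 1 - p 0 < n + 1 ∧ -(n : ℝ) < p 0 ∧
      (p 0 + p 1 < n ∨ p 0 + p 1 < n + 1 ∧ p 0 < j) := by
  simp only [northEastTile, mem_union, mem_openPolygon, Fin.forall_fin_succ, IsEmpty.forall_iff,
    and_true, Matrix.cons_val_zero, Matrix.cons_val_succ]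
  push_cast
  grind

variable {n j : ℤ}

theorem isOpen_northEastTile : IsOpen (northEastTile n j) :=
  isOpen_openPolygon.union isOpen_openPolygon

theorem zero_mem_openPolygon_northEast (hj : 1 ≤ j) (hjn : j ≤ n) :
    0 ∈ openPolygon ![(-1, -1), (1, -1), (-1, 1), (-1, 0), (1, 1)] ![n, n, n + 1, n, n] ∧
      0 ∈ openPolygon ![(-1, -1), (1, -1), (-1, 1), (-1, 0), (1, 1), (1, 0)]
        ![n, n, n + 1, n, n + 1, j] := by
  simp only [openPolygon, inner_zero_right, mem_ofPred_eq, Int.cast_pos, Fin.forall_fin_succ,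
    IsEmpty.forall_iff, and_true, Matrix.cons_val_zero, Matrix.cons_val_succ]
  omega

theorem mem_closure_northEastTile (hj : 1 ≤ j) (hjn : j ≤ n) {p : Plane} :
    p ∈ closure (northEastTile n j) ↔
      -(n : ℝ) ≤ p 0 + p 1 ∧ -(n : ℝ) ≤ p 1 - p 0 ∧ p 1 - p 0 ≤ n + 1 ∧ -(n : ℝ) ≤ p 0 ∧
        (p 0 + p 1 ≤ n ∨ p 0 + p 1 ≤ n + 1 ∧ p 0 ≤ j) := by
  obtain ⟨hl, hr⟩ := zero_mem_openPolygon_northEast hj hjn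
  rw [northEastTile, closure_union, closure_openPolygon ⟨0, hl⟩, closure_openPolygon ⟨0, hr⟩]
  simp only [mem_union, mem_closedPolygon, Fin.forall_fin_succ, IsEmpty.forall_iff, and_true,
    Matrix.cons_val_zero, Matrix.cons_val_succ]
  push_cast
  grind

theorem mem_sitePerim_northEastStage (hj : 1 ≤ j) (hjn : j ≤ n) (a b : ℤ) :
    (a, b) ∈ sitePerim (northEastStage n j) ↔
      -n ≤ a + b ∧ -n ≤ b - a ∧ b - a ≤ n + 1 ∧ -n ≤ a ∧ (a + b ≤ n ∨ (a + b ≤ n + 1 ∧ a ≤ j)) ∧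
      (a + b = -n ∨ b - a = -n ∨ b - a = n + 1 ∨ (n ≤ a + b ∧ (a + b = n + 1 ∨ j ≤ a))) := by
  rw [mem_sitePerim_iff]
  simp only [northEastStage, mem_ofPred_eq]
  omega

theorem extPerim_northEastStage (hj : 1 ≤ j) (hjn : j ≤ n) :
    extPerim (northEastStage n j) = sitePerim (northEastStage n j) := by
  refine extPerim_eq_sitePerim ?_
  rintro ⟨a, b⟩ hz
  simp only [mem_sitePerim_northEastStage hj hjn] at hz ⊢
  obtain h | h | h | h := hz.2.2.2.2.2
  · exact ⟨(-1, 0), by simp [d4], by omega⟩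
  · exact ⟨(0, -1), by simp [d4], by omega⟩
  · exact ⟨(0, 1), by simp [d4], by omega⟩
  · exact ⟨(1, 0), by simp [d4], by omega⟩

theorem extCurve_northEastStage_subset (hj : 1 ≤ j) (hjn : j ≤ n) :
    extCurve (northEastStage n j) ⊆ frontier (northEastTile n j) := by
  obtain ⟨hl, hr⟩ := zero_mem_openPolygon_northEast hj hjn
  refine extCurve_subset_frontier_union_openPolygon ⟨0, hl⟩ ⟨0, hr⟩ ?_
  rintro ⟨a, b⟩ hp ⟨a', b'⟩ hq hpq
  simp only [mem_sitePerim_northEastStage hj hjn, d8_eq_one_iff, abs_le] at hp hq hpq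
  obtain ⟨p1, p2, p3, p4, p5, p6⟩ := hp
  obtain ⟨q1, q2, q3, _, q5, q6⟩ := hq
  simp only [emb_mem_closedPolygon, Fin.forall_fin_succ, Fin.exists_fin_succ, IsEmpty.forall_iff,
    IsEmpty.exists_iff, and_true, or_false, Matrix.cons_val_zero, Matrix.cons_val_succ]
  refine ⟨by omega, ?_⟩
  rcases p6 with p6 | p6 | p6 | p6 <;> rcases q6 with q6 | q6 | q6 | q6 <;> omega

theorem frontier_northEastTile_subset (hj : 1 ≤ j) (hjn : j ≤ n) :
    frontier (northEastTile n j) ⊆ extCurve (northEastStage n j) := by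
  have hT := extPerim_northEastStage hj hjn
  rintro x ⟨hx, hx'⟩
  rw [isOpen_northEastTile.interior_eq, mem_northEastTile] at hx'
  rw [mem_closure_northEastTile hj hjn] at hx
  obtain ⟨hsw, hse, hnw, hw, hne⟩ := hx
  have : (1 : ℝ) ≤ j := by exact_mod_cast hj
  have hjnR : (j : ℝ) ≤ n := by exact_mod_cast hjn
  have hside : x 0 + x 1 = -n ∨ x 1 - x 0 = -n ∨ x 1 - x 0 = n + 1 ∨ x 0 = -n ∨
      (x 0 + x 1 = n + 1 ∧ x 0 ≤ j) ∨ (n ≤ x 0 + x 1 ∧ x 0 = j) ∨ (x 0 + x 1 = n ∧ j < x 0) := by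
    by_contra! hcon
    obtain ⟨c1, c2, c3, c4, c5, c6, c7⟩ := hcon
    refine hx' ⟨hsw.lt_of_ne' c1, hse.lt_of_ne' c2, hnw.lt_of_ne c3, hw.lt_of_ne' c4, ?_⟩
    refine or_iff_not_imp_left.2 fun h => ?_
    rw [not_lt] at h
    rcases hne with hne | ⟨hne, hx0⟩
    · exact ⟨by linarith, (c7 (hne.antisymm h)).lt_of_ne (c6 h)⟩
    · exact ⟨hne.lt_of_ne fun he => (c5 he).not_ge hx0, hx0.lt_of_ne (c6 h)⟩
  have hsum : x 0 + x 1 ≤ n + 1 := by rcases hne with hne | ⟨hne, -⟩ <;> linarith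
  have hx0 : x 0 ≤ n := by rcases hne with hne | ⟨-, hne⟩ <;> linarith
  have hrun (p d : Pixel) (m : ℤ) := mem_extCurve_of_run hT (p := p) (d := d) (m := m) (x := x)
  simp only [mem_sitePerim_northEastStage hj hjn] at hrun
  rcases hside with h | h | h | h | ⟨h, h'⟩ | ⟨h, h'⟩ | ⟨h, h'⟩
  · refine hrun (0, -n) (-1, 1) n (by simp [d8]) (by omega) (by omega) (-x 0) ?_ ?_ ?_ ?_ <;>
      push_cast <;> linarith
  · refine hrun (0, -n) (1, 1) n (by simp [d8]) (by omega) (by omega) (x 0) ?_ ?_ ?_ ?_ <;>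
      push_cast <;> linarith
  · refine hrun (0, n + 1) (-1, -1) n (by simp [d8]) (by omega) (by omega) (-x 0) ?_ ?_ ?_ ?_ <;>
      push_cast <;> linarith
  · refine hrun (-n, 0) (0, 1) 1 (by simp [d8]) (by omega) (by omega) (x 1) ?_ ?_ ?_ ?_ <;>
      push_cast <;> linarith
  · refine hrun (0, n + 1) (1, -1) j (by simp [d8]) (by omega) (by omega) (x 0) ?_ ?_ ?_ ?_ <;>
      push_cast <;> linarith
  · refine hrun (j, n - j) (0, 1) 1 (by simp [d8]) (by omega) (by omega) (x 0 + x 1 - n) ?_ ?_ ?_ ?_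
      <;> push_cast <;> linarith
  · have hjn' : j < n := Int.cast_lt.1 (h'.trans_le hx0)
    refine hrun (n, 0) (-1, 1) (n - j) (by simp [d8]) (by omega) (by omega) (n - x 0) ?_ ?_ ?_ ?_
      <;> push_cast <;> linarith

theorem polygonalTile_northEastStage (hj : 1 ≤ j) (hjn : j ≤ n) :
    polygonalTile (northEastStage n j) = northEastTile n j := by
  refine polygonalTile_eq_of_convex_union convex_openPolygon convex_openPolygon isOpen_openPolygon
    isOpen_openPolygon (isBounded_of_abs_apply_le (n + 1) fun p hp => ?_)
    ((extCurve_northEastStage_subset hj hjn).antisymm (frontier_northEastTile_subset hj hjn))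
    fun z hz => ?_
  · obtain ⟨hsw, hse, hnw, -, hne⟩ := mem_northEastTile.1 hp
    have hsum : p 0 + p 1 < n + 1 := by rcases hne with hne | ⟨hne, -⟩ <;> linarith
    simp only [abs_le]
    refine ⟨⟨?_, ?_⟩, ?_, ?_⟩ <;> linarith
  · have := mem_northEastTile.1 hz
    simp only [emb_apply_zero, emb_apply_one] at this
    norm_cast at this
    simp only [northEastStage, mem_ofPred_eq]
    omega

end NorthEastTile

section SouthWestTile

/-- The polygonal tile of the spiral after `s₃ (n - 1) + j` steps: a square with a truncated corner,
with a strip of width one added along part of its south-west side. -/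
def southWestTile (n j : ℤ) : Set Plane :=
  openPolygon ![(1, 1), (1, -1), (-1, 1), (-1, -1), (-1, 0)] ![n, n, n, n - 1, n - 1] ∪
    openPolygon ![(1, 1), (1, -1), (-1, 1), (-1, -1), (-1, 0)] ![n, n, n, n, j]

theorem mem_southWestTile {n j : ℤ} {p : Plane} : p ∈ southWestTile n j ↔
    p 0 + p 1 < n ∧ -(n : ℝ) < p 1 - p 0 ∧ p 1 - p 0 < n ∧
      (-(n : ℝ) + 1 < p 0 + p 1 ∧ -(n : ℝ) + 1 < p 0 ∨ -(n : ℝ) < p 0 + p 1 ∧ -(j : ℝ) < p 0) := by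
  simp only [southWestTile, mem_union, mem_openPolygon, Fin.forall_fin_succ, IsEmpty.forall_iff,
    and_true, Matrix.cons_val_zero, Matrix.cons_val_succ]
  push_cast
  grind

variable {n j : ℤ}

theorem isOpen_southWestTile : IsOpen (southWestTile n j) :=
  isOpen_openPolygon.union isOpen_openPolygon

theorem nonempty_openPolygon_southWest (hj : 1 ≤ j) (hjn : j ≤ n) :
    (openPolygon ![(1, 1), (1, -1), (-1, 1), (-1, -1), (-1, 0)] ![n, n, n, n - 1, n - 1]).Nonempty ∧
      (openPolygon ![(1, 1), (1, -1), (-1, 1), (-1, -1), (-1, 0)] ![n, n, n, n, j]).Nonempty := by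
  have hjR : (1 : ℝ) ≤ j := by exact_mod_cast hj
  have hjnR : (j : ℝ) ≤ n := by exact_mod_cast hjn
  refine ⟨⟨!₂[1 / 4, 1 / 4], ?_⟩, ⟨!₂[1 / 4, 1 / 4], ?_⟩⟩ <;>
    simp only [mem_openPolygon, Fin.forall_fin_succ, IsEmpty.forall_iff, and_true,
      Matrix.cons_val_zero, Matrix.cons_val_succ, Matrix.cons_val_one] <;>
    refine ⟨?_, ?_, ?_, ?_, ?_⟩ <;> push_cast <;> linarith

theorem mem_closure_southWestTile (hj : 1 ≤ j) (hjn : j ≤ n) {p : Plane} :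
    p ∈ closure (southWestTile n j) ↔
      p 0 + p 1 ≤ n ∧ -(n : ℝ) ≤ p 1 - p 0 ∧ p 1 - p 0 ≤ n ∧
        (-(n : ℝ) + 1 ≤ p 0 + p 1 ∧ -(n : ℝ) + 1 ≤ p 0 ∨
          -(n : ℝ) ≤ p 0 + p 1 ∧ -(j : ℝ) ≤ p 0) := by
  obtain ⟨hl, hr⟩ := nonempty_openPolygon_southWest hj hjn
  rw [southWestTile, closure_union, closure_openPolygon hl, closure_openPolygon hr]
  simp only [mem_union, mem_closedPolygon, Fin.forall_fin_succ, IsEmpty.forall_iff, and_true,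
    Matrix.cons_val_zero, Matrix.cons_val_succ]
  push_cast
  grind

theorem mem_sitePerim_southWestStage (hj : 1 ≤ j) (hjn : j ≤ n) (a b : ℤ) :
    (a, b) ∈ sitePerim (southWestStage (n - 1) j) ↔
      a + b ≤ n ∧ -n ≤ b - a ∧ b - a ≤ n ∧
      ((-n + 1 ≤ a + b ∧ -n + 1 ≤ a) ∨ (-n ≤ a + b ∧ -j ≤ a)) ∧
      (a + b = n ∨ b - a = -n ∨ b - a = n ∨ a + b = -n ∨ (a + b = -n + 1 ∧ a ≤ -j)) := by
  rw [mem_sitePerim_iff]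
  simp only [southWestStage, mem_ofPred_eq]
  omega

theorem extPerim_southWestStage (hj : 1 ≤ j) (hjn : j ≤ n) :
    extPerim (southWestStage (n - 1) j) = sitePerim (southWestStage (n - 1) j) := by
  refine extPerim_eq_sitePerim ?_
  rintro ⟨a, b⟩ hz
  simp only [mem_sitePerim_southWestStage hj hjn] at hz ⊢
  rcases hz.2.2.2.2 with h | h | h | h
  · exact ⟨(1, 0), by simp [d4], by omega⟩
  · exact ⟨(0, -1), by simp [d4], by omega⟩
  · exact ⟨(0, 1), by simp [d4], by omega⟩
  · exact ⟨(-1, 0), by simp [d4], by omega⟩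

theorem extCurve_southWestStage_subset (hj : 1 ≤ j) (hjn : j ≤ n) :
    extCurve (southWestStage (n - 1) j) ⊆ frontier (southWestTile n j) := by
  obtain ⟨hl, hr⟩ := nonempty_openPolygon_southWest hj hjn
  refine extCurve_subset_frontier_union_openPolygon hl hr ?_
  rintro ⟨a, b⟩ hp ⟨a', b'⟩ hq hpq
  simp only [mem_sitePerim_southWestStage hj hjn, d8_eq_one_iff, abs_le] at hp hq hpq
  simp only [emb_mem_closedPolygon, Fin.forall_fin_succ, Fin.exists_fin_succ, IsEmpty.forall_iff,
    IsEmpty.exists_iff, and_true, or_false, Matrix.cons_val_zero, Matrix.cons_val_succ]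
  obtain ⟨p1, p2, p3, p4, p5⟩ := hp
  obtain ⟨q1, q2, q3, q4, q5⟩ := hq
  refine ⟨by omega, ?_⟩
  rcases p5 with p5 | p5 | p5 | p5 | p5 <;> rcases q5 with q5 | q5 | q5 | q5 | q5 <;> omega

theorem mem_extCurve_southWestStage_of_le (hj : 1 ≤ j) (hjn : j ≤ n) {x : Plane}
    (hx : x ∈ closure (southWestTile n j)) (hsum : -n < x 0 + x 1) (hxj : x 0 ≤ -j)
    (hcorner : x 0 + x 1 ≤ -n + 1 ∨ x 0 ≤ -n + 1) : x ∈ extCurve (southWestStage (n - 1) j) := by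
  rw [mem_closure_southWestTile hj hjn] at hx
  obtain ⟨-, -, hnw, hsw⟩ := hx
  have hxn : (-n : ℝ) < x 0 := by linarith
  have hjn' : j ≤ n - 1 := Int.le_sub_one_iff.2 (Int.cast_lt.1 (by linarith : (j : ℝ) < n))
  have hjnR : (j : ℝ) ≤ n - 1 := by exact_mod_cast hjn'
  have hw : -n + 1 ≤ x 0 := by rcases hsw with h | h <;> linarith
  have hside : (x 0 + x 1 ≤ -n + 1 ∧ x 0 = -j) ∨ (x 0 + x 1 = -n + 1 ∧ x 0 < -j) ∨
      (-n + 1 < x 0 + x 1 ∧ x 0 = -n + 1) := by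
    rcases le_or_gt (x 0 + x 1) (-n + 1) with h | h
    · rcases hxj.eq_or_lt with h' | h'
      · exact Or.inl ⟨h, h'⟩
      · exact Or.inr (Or.inl ⟨by rcases hsw with h | h <;> linarith, h'⟩)
    · exact Or.inr (Or.inr ⟨h, by rcases hcorner with h | h <;> linarith⟩)
  have hrun (p d : Pixel) (m : ℤ) := mem_extCurve_of_run (extPerim_southWestStage hj hjn)
    (p := p) (d := d) (m := m) (x := x)
  simp only [mem_sitePerim_southWestStage hj hjn] at hrun
  rcases hside with ⟨h, h'⟩ | ⟨h, h'⟩ | ⟨h, h'⟩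
  · refine hrun (-j, -n + j) (0, 1) 1 (by simp [d8]) (by omega) (by omega) (x 0 + x 1 + n)
      ?_ ?_ ?_ ?_
      <;> push_cast <;> linarith
  · have hjn'' : j < n - 1 := by
      have : (j : ℝ) < n - 1 := by linarith
      exact_mod_cast this
    refine hrun (-j, -n + 1 + j) (-1, 1) (n - 1 - j) (by simp [d8]) (by omega) (by omega) (-j - x 0)
      ?_ ?_ ?_ ?_ <;> push_cast <;> linarith
  · refine hrun (-n + 1, 0) (0, 1) 1 (by simp [d8]) (by omega) (by omega) (x 1) ?_ ?_ ?_ ?_ <;>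
      push_cast <;> linarith

theorem frontier_southWestTile_subset (hj : 1 ≤ j) (hjn : j ≤ n) :
    frontier (southWestTile n j) ⊆ extCurve (southWestStage (n - 1) j) := by
  rintro x ⟨hx, hx'⟩
  rw [isOpen_southWestTile.interior_eq, mem_southWestTile] at hx'
  obtain ⟨hne, hse, hnw, hsw⟩ := (mem_closure_southWestTile hj hjn).1 hx
  have : (1 : ℝ) ≤ j := by exact_mod_cast hj
  have : (j : ℝ) ≤ n := by exact_mod_cast hjn
  have hsum : -n ≤ x 0 + x 1 := by rcases hsw with h | h <;> linarith
  have hside : x 0 + x 1 = n ∨ x 1 - x 0 = -n ∨ x 1 - x 0 = n ∨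
      ((x 0 + x 1 ≤ -n + 1 ∨ x 0 ≤ -n + 1) ∧ (x 0 + x 1 ≤ -n ∨ x 0 ≤ -j)) := by
    by_contra! hcon
    obtain ⟨c1, c2, c3, c4⟩ := hcon
    refine hx' ⟨hne.lt_of_ne c1, hse.lt_of_ne' c2, hnw.lt_of_ne c3, ?_⟩
    by_cases hc : x 0 + x 1 ≤ -n + 1 ∨ x 0 ≤ -n + 1
    · exact Or.inr (c4 hc)
    · exact Or.inl (by simpa only [not_or, not_le] using hc)
  have hrun (p d : Pixel) (m : ℤ) := mem_extCurve_of_run (extPerim_southWestStage hj hjn)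
    (p := p) (d := d) (m := m) (x := x)
  simp only [mem_sitePerim_southWestStage hj hjn] at hrun
  rcases hsum.eq_or_lt' with h | hsum'
  · refine hrun (0, -n) (-1, 1) j (by simp [d8]) (by omega) (by omega) (-x 0) ?_ ?_ ?_ ?_
    · linarith
    · rcases hsw with h | h <;> linarith
    all_goals push_cast; linarith
  rcases hside with h | h | h | ⟨h, h'⟩
  · refine hrun (n, 0) (-1, 1) n (by simp [d8]) (by omega) (by omega) (n - x 0) ?_ ?_ ?_ ?_ <;>
      push_cast <;> linarith
  · refine hrun (0, -n) (1, 1) n (by simp [d8]) (by omega) (by omega) (x 0) ?_ ?_ ?_ ?_ <;>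
      push_cast <;> linarith
  · refine hrun (0, n) (-1, -1) (max j (n - 1)) (by simp [d8]) (by omega) (by omega) (-x 0)
      ?_ ?_ ?_ ?_
    · linarith
    · push_cast
      exact le_max_iff.2 (hsw.symm.imp (fun h => by linarith) fun h => by linarith)
    all_goals push_cast; linarith
  · exact mem_extCurve_southWestStage_of_le hj hjn hx hsum' (h'.resolve_left hsum'.not_ge) h

theorem polygonalTile_southWestStage (hj : 1 ≤ j) (hjn : j ≤ n) :
    polygonalTile (southWestStage (n - 1) j) = southWestTile n j := by
  refine polygonalTile_eq_of_convex_union convex_openPolygon convex_openPolygon isOpen_openPolygon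
    isOpen_openPolygon (isBounded_of_abs_apply_le (n + 1) fun p hp => ?_)
    ((extCurve_southWestStage_subset hj hjn).antisymm (frontier_southWestTile_subset hj hjn))
    fun z hz => ?_
  · obtain ⟨hne, hse, hnw, hsw⟩ := mem_southWestTile.1 hp
    have hsum : -n < p 0 + p 1 := by rcases hsw with ⟨h, -⟩ | ⟨h, -⟩ <;> linarith
    simp only [abs_le]
    refine ⟨⟨?_, ?_⟩, ?_, ?_⟩ <;> linarith
  · have := mem_southWestTile.1 hz
    simp only [emb_apply_zero, emb_apply_one] at this
    norm_cast at this
    simp only [southWestStage, mem_ofPred_eq]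
    omega

end SouthWestTile

section Lattice

theorem mem_columnLattice_iff (M : Matrix (Fin 2) (Fin 2) ℤ) (y : Plane) : y ∈ columnLattice M ↔
    ∃ α β : ℤ, y 0 = α * M 0 0 + β * M 0 1 ∧ y 1 = α * M 1 0 + β * M 1 1 := by
  have hr : (range fun c : Fin 2 => emb (M 0 c, M 1 c)) =
      {emb (M 0 0, M 1 0), emb (M 0 1, M 1 1)} := by
    ext x
    simp only [mem_range, Fin.exists_fin_two, mem_insert_iff, mem_singleton_iff, eq_comm]
  rw [columnLattice, hr, AddSubgroup.mem_closure_pair]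
  refine exists_congr fun α => exists_congr fun β => ⟨?_, fun h => plane_ext ?_ ?_⟩
  · rintro rfl
    simp [emb]
  · simpa [emb] using h.1.symm
  · simpa [emb] using h.2.symm

variable {H : ℝ} (hH : 0 < H) {a c : ℝ} {L₀ : ℝ → ℝ}

/-- The function that agrees with `L₀` on `[a, a + H)` and satisfies `L (v + H) = L v + c`. -/
noncomputable def quasiExtension (a c : ℝ) (L₀ : ℝ → ℝ) (v : ℝ) : ℝ :=
  L₀ (toIcoMod hH a v) + toIcoDiv hH a v * c

theorem quasiExtension_eq (m : ℤ) {v : ℝ} (hv : v - m * H ∈ Ico a (a + H)) :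
    quasiExtension hH a c L₀ v = L₀ (v - m * H) + m * c := by
  have hm : toIcoDiv hH a v = m := toIcoDiv_eq_of_sub_zsmul_mem_Ico hH (by rwa [zsmul_eq_mul])
  rw [quasiExtension, toIcoMod, hm, zsmul_eq_mul]

theorem quasiExtension_of_mem {v : ℝ} (hv : v ∈ Ico a (a + H)) :
    quasiExtension hH a c L₀ v = L₀ v := by
  simpa using quasiExtension_eq hH (c := c) (L₀ := L₀) 0 (by simpa using hv)

theorem quasiExtension_add_mul (v : ℝ) (m : ℤ) :
    quasiExtension hH a c L₀ (v + m * H) = quasiExtension hH a c L₀ v + m * c := by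
  rw [quasiExtension, quasiExtension, ← zsmul_eq_mul, toIcoMod_add_zsmul, toIcoDiv_add_zsmul]
  push_cast
  ring

theorem monotone_quasiExtension (hc : 0 ≤ c) (hL : Monotone L₀) (hend : L₀ (a + H) ≤ L₀ a + c) :
    Monotone (quasiExtension hH a c L₀) := by
  intro v w hvw
  have hv := toIcoMod_mem_Ico hH a v
  have hw := toIcoMod_mem_Ico hH a w
  have hv' := toIcoMod_add_toIcoDiv_zsmul hH a v
  have hw' := toIcoMod_add_toIcoDiv_zsmul hH a w
  rw [zsmul_eq_mul] at hv' hw'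
  simp only [quasiExtension]
  rcases lt_trichotomy (toIcoDiv hH a v) (toIcoDiv hH a w) with h | h | h
  · have h' : (toIcoDiv hH a v : ℝ) + 1 ≤ toIcoDiv hH a w := by exact_mod_cast h
    have h₁ : L₀ (toIcoMod hH a v) ≤ L₀ (a + H) := hL hv.2.le
    have h₂ : L₀ a ≤ L₀ (toIcoMod hH a w) := hL hw.1
    linarith [mul_le_mul_of_nonneg_right h' hc]
  · rw [h] at hv' ⊢
    gcongr
    exact hL (by linarith)
  · have h' : (toIcoDiv hH a w : ℝ) + 1 ≤ toIcoDiv hH a v := by exact_mod_cast h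
    linarith [mul_le_mul_of_nonneg_right h' hH.le, hv.1, hw.2]

/-- The height over `v` of the `m`-th translate of the graph of `L` by the vector `(-s, W)`. -/
def layer (L : ℝ → ℝ) (s W v : ℝ) (m : ℤ) : ℝ := L (v + m * s) + m * W

variable {L : ℝ → ℝ} {s W : ℝ}

theorem layer_shift (hL : ∀ (v : ℝ) (k : ℤ), L (v + k * H) = L v + k * c) (v : ℝ) (k b m : ℤ) :
    layer L s W (v + k * H + b * s) m = layer L s W v (m + b) + k * c - b * W := by
  rw [layer, layer,
    show v + k * H + b * s + m * s = v + ↑(m + b) * s + k * H by push_cast; ring, hL]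
  push_cast
  ring

theorem monotone_layer (hmono : Monotone L) (hs : 0 ≤ s) (hW : 0 ≤ W) (v : ℝ) :
    Monotone (layer L s W v) := by
  intro m k hmk
  have h : (m : ℝ) ≤ k := by exact_mod_cast hmk
  exact add_le_add (hmono (by gcongr)) (by gcongr)

theorem exists_mem_Ico_layer (hmono : Monotone L) (hs : 0 ≤ s) (hW : 0 < W) (u v : ℝ) :
    ∃ m : ℤ, u ∈ Ico (layer L s W v m) (layer L s W v (m + 1)) := by
  have hbdd : ∀ m : ℤ, layer L s W v m ≤ u → m ≤ max 0 ⌈(u - L v) / W⌉ := by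
    intro m hm
    rcases le_total m 0 with h | h
    · exact h.trans (le_max_left _ _)
    · have : (0 : ℝ) ≤ m := by exact_mod_cast h
      have h₁ : L v ≤ L (v + m * s) := hmono (le_add_of_nonneg_right (by positivity))
      have h₂ : (m : ℝ) ≤ (u - L v) / W := by rw [le_div_iff₀ hW]; unfold layer at hm; linarith
      exact le_max_of_le_right (by exact_mod_cast h₂.trans (Int.le_ceil _))
  have hex : layer L s W v (min 0 ⌊(u - L v) / W⌋) ≤ u := by
    set m := min 0 ⌊(u - L v) / W⌋
    have h₀ : (m : ℝ) ≤ 0 := by exact_mod_cast min_le_left _ _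
    have h₁ : L (v + m * s) ≤ L v :=
      hmono (add_le_of_nonpos_right (mul_nonpos_of_nonpos_of_nonneg h₀ hs))
    have h₂ : (m : ℝ) ≤ (u - L v) / W :=
      (Int.cast_le.2 (min_le_right _ _)).trans (Int.floor_le _)
    rw [le_div_iff₀ hW] at h₂
    unfold layer
    linarith
  obtain ⟨m, hm, hmax⟩ := Int.exists_greatest_of_bdd ⟨_, hbdd⟩ ⟨_, hex⟩
  exact ⟨m, hm, lt_of_not_ge fun h => (hmax _ h).not_gt (Int.lt_succ m)⟩

include hH in
theorem exists_shift_mem (hs : 0 ≤ s) (hW : 0 < W) (hmono : Monotone L)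
    (hL : ∀ (v : ℝ) (k : ℤ), L (v + k * H) = L v + k * c) (a u v : ℝ) :
    ∃ α β : ℤ, v + α * H + β * s ∈ Ico a (a + H) ∧
      u + α * c - β * W ∈ Icc (L (v + α * H + β * s)) (L (v + α * H + β * s + s) + W) := by
  obtain ⟨β, hβ⟩ := exists_mem_Ico_layer hmono hs hW u v
  set α : ℤ := -toIcoDiv hH a (v + β * s)
  have hα : v + α * H + β * s ∈ Ico a (a + H) := by
    convert sub_toIcoDiv_zsmul_mem_Ico hH a (v + β * s) using 1
    rw [zsmul_eq_mul]
    push_cast [α]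
    ring
  have h₀ := layer_shift (s := s) (W := W) hL v α β 0
  have h₁ := layer_shift (s := s) (W := W) hL v α β 1
  simp only [layer, Int.cast_zero, Int.cast_one, zero_mul, one_mul, add_zero, zero_add] at h₀ h₁
  simp only [layer, mem_Ico, add_comm β 1] at hβ
  exact ⟨α, β, hα, by linarith [hβ.1], by linarith [hβ.2]⟩

include hH in
theorem eq_zero_of_shift_mem (hs : 0 ≤ s) (hW : 0 < W) (hmono : Monotone L)
    (hL : ∀ (v : ℝ) (k : ℤ), L (v + k * H) = L v + k * c) {u v : ℝ} {α β : ℤ}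
    (hv : v ∈ Ioo a (a + H)) (hu : u ∈ Ioo (L v) (L (v + s) + W))
    (hv' : v + α * H + β * s ∈ Ioo a (a + H))
    (hu' : u + α * c - β * W ∈ Ioo (L (v + α * H + β * s)) (L (v + α * H + β * s + s) + W)) :
    α = 0 ∧ β = 0 := by
  have hβ : β = 0 := by
    by_contra hne
    have h₀ := layer_shift (s := s) (W := W) hL v α β 0
    have h₁ := layer_shift (s := s) (W := W) hL v α β 1
    have hdisj := (monotone_layer hmono hs hW.le v).pairwise_disjoint_on_Ioo_succ hne
    simp only [layer, Int.cast_zero, Int.cast_one, zero_mul, one_mul, add_zero, zero_add] at h₀ h₁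
    simp only [Function.onFun, layer, Order.succ_eq_add_one, zero_add, Int.cast_zero, Int.cast_one,
      zero_mul, one_mul, add_zero, add_comm β 1] at hdisj
    exact disjoint_left.1 hdisj ⟨by linarith [hu'.1], by linarith [hu'.2]⟩ hu
  subst hβ
  simp only [Int.cast_zero, zero_mul, add_zero] at hv'
  have hlt : (α : ℝ) < 1 := lt_of_mul_lt_mul_right (by linarith [hv.1, hv'.2]) hH.le
  have hgt : (-1 : ℝ) < α := lt_of_mul_lt_mul_right (by linarith [hv.2, hv'.1]) hH.le
  exact ⟨le_antisymm (Int.lt_add_one_iff.1 (by exact_mod_cast hlt)) (by exact_mod_cast hgt), rfl⟩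

include hH in
-- In the coordinates `v = y - x` and `u = x + y` the columns of `M` are `(-H, -c)` and `(-s, W)`.
theorem tilesByLattice_of_between (hs : 0 ≤ s) (hW : 0 < W) (hmono : Monotone L)
    (hL : ∀ (v : ℝ) (k : ℤ), L (v + k * H) = L v + k * c)
    {M : Matrix (Fin 2) (Fin 2) ℤ} (hMc : (M 0 0 + M 1 0 : ℝ) = -c)
    (hMH : (M 1 0 - M 0 0 : ℝ) = -H) (hMW : (M 0 1 + M 1 1 : ℝ) = W)
    (hMs : (M 1 1 - M 0 1 : ℝ) = -s) {F : Set Plane} (hFo : IsOpen F)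
    (hF : ∀ p ∈ F, p 1 - p 0 ∈ Ioo a (a + H) ∧
      p 0 + p 1 ∈ Ioo (L (p 1 - p 0)) (L (p 1 - p 0 + s) + W))
    (hcl : ∀ p : Plane, p 1 - p 0 ∈ Ico a (a + H) →
      p 0 + p 1 ∈ Icc (L (p 1 - p 0)) (L (p 1 - p 0 + s) + W) → p ∈ closure F) :
    TilesByLattice F (columnLattice M) := by
  have hv : ∀ {p q y : Plane} {α β : ℤ}, q + y = p → y 0 = α * M 0 0 + β * M 0 1 →
      y 1 = α * M 1 0 + β * M 1 1 → q 1 - q 0 = p 1 - p 0 + α * H + β * s := by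
    rintro _ q y α β rfl h₀ h₁
    rw [PiLp.add_apply, PiLp.add_apply, h₀, h₁]
    linear_combination (-(α : ℝ)) * hMH - β * hMs
  have hu : ∀ {p q y : Plane} {α β : ℤ}, q + y = p → y 0 = α * M 0 0 + β * M 0 1 →
      y 1 = α * M 1 0 + β * M 1 1 → q 0 + q 1 = p 0 + p 1 + α * c - β * W := by
    rintro _ q y α β rfl h₀ h₁
    rw [PiLp.add_apply, PiLp.add_apply, h₀, h₁]
    linear_combination (-(α : ℝ)) * hMc - β * hMW
  refine ⟨hFo, eq_univ_of_forall fun p => ?_, fun y hy z hz hyz => ?_⟩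
  · obtain ⟨α, β, hαβ⟩ := exists_shift_mem hH hs hW hmono hL a (p 0 + p 1) (p 1 - p 0)
    set y : Plane := !₂[(α * M 0 0 + β * M 0 1 : ℝ), α * M 1 0 + β * M 1 1]
    have hy := sub_add_cancel p y
    rw [← hv hy rfl rfl, ← hu hy rfl rfl] at hαβ
    exact mem_iUnion₂.2 ⟨y, (mem_columnLattice_iff M y).2 ⟨α, β, rfl, rfl⟩, p - y,
      hcl _ hαβ.1 hαβ.2, hy⟩
  · rw [disjoint_left]
    rintro _ ⟨p, hp, rfl⟩ ⟨q, hq, hqp⟩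
    obtain ⟨α, β, h₀, h₁⟩ := (mem_columnLattice_iff M _).1 (sub_mem hz hy)
    have hpq : q + (z - y) = p := by rw [← add_sub_assoc, sub_eq_iff_eq_add]; exact hqp
    have hq' := hF q hq
    rw [hv hpq h₀ h₁, hu hpq h₀ h₁] at hq'
    obtain ⟨rfl, rfl⟩ := eq_zero_of_shift_mem hH hs hW hmono hL (hF p hp).1 (hF p hp).2 hq'.1 hq'.2
    simp only [Int.cast_zero, zero_mul, add_zero] at h₀ h₁
    exact hyz (sub_eq_zero.1 (plane_ext h₀ h₁)).symm

end Lattice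

section NorthEastTiling

variable {n j : ℤ}

/-- The south-west boundary of `northEastTile n j` as a graph over `v = y - x` with height
`u = x + y`, continued to all `v` by the period of the tiling. -/
noncomputable def northEastProfile (hn : (0 : ℝ) < 2 * n + 1) : ℝ → ℝ :=
  quasiExtension hn (-n) 1 fun v => max (-n) (v - 2 * n)

theorem monotone_northEastProfile (hn : (0 : ℝ) < 2 * n + 1) : Monotone (northEastProfile hn) := by
  refine monotone_quasiExtension hn zero_le_one (fun v w hvw => ?_) ?_
  · exact max_le_max le_rfl (by linarith)
  · exact max_le (by linarith [le_max_left (-n : ℝ) (-n - 2 * n)])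
      (by linarith [le_max_left (-n : ℝ) (-n - 2 * n)])

theorem northEastProfile_eq (hn : (0 : ℝ) < 2 * n + 1) {v : ℝ}
    (hv : v ∈ Ico (-n : ℝ) (-n + (2 * n + 1))) :
    northEastProfile hn v = max (-n : ℝ) (v - 2 * n) :=
  quasiExtension_of_mem hn hv

theorem northEastProfile_add (hn : (0 : ℝ) < 2 * n + 1) (hj : 1 ≤ j) (hjn : j ≤ n) {v : ℝ}
    (hv : v ∈ Ico (-n : ℝ) (-n + (2 * n + 1))) :
    northEastProfile hn (v + 2 * j) + 2 * n = max (n : ℝ) (min (n + 1) (v + 2 * j)) := by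
  have hjR : (1 : ℝ) ≤ j := by exact_mod_cast hj
  have hjnR : (j : ℝ) ≤ n := by exact_mod_cast hjn
  obtain ⟨hv₁, hv₂⟩ := hv
  rcases lt_or_ge (v + 2 * j) (n + 1) with h | h
  · rw [northEastProfile_eq hn ⟨by linarith, by linarith⟩, min_eq_right h.le, ← max_add_add_right]
    ring_nf
  · have hmem : v + 2 * j - (1 : ℤ) * (2 * n + 1) ∈ Ico (-n : ℝ) (-n + (2 * n + 1)) := by
      rw [Int.cast_one, one_mul]
      constructor <;> linarith
    rw [northEastProfile, quasiExtension_eq hn 1 hmem, Int.cast_one, one_mul,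
      max_eq_left (by linarith), min_eq_left h, max_eq_right (by linarith)]
    ring

theorem tilesByLattice_northEastTile (hj : 1 ≤ j) (hjn : j ≤ n) :
    TilesByLattice (northEastTile n j) (columnLattice !![n, n + j; -n - 1, n - j]) := by
  have hjR : (1 : ℝ) ≤ j := by exact_mod_cast hj
  have hjnR : (j : ℝ) ≤ n := by exact_mod_cast hjn
  have hn : (0 : ℝ) < 2 * n + 1 := by linarith
  refine tilesByLattice_of_between hn (a := -n) (c := 1) (s := 2 * j) (W := 2 * n) (by linarith)
    (by linarith) (monotone_northEastProfile hn) (quasiExtension_add_mul hn) (by simp; ring)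
    (by simp; ring) (by simp; ring) (by simp; ring) isOpen_northEastTile (fun p hp => ?_)
    fun p hv hu => ?_
  · obtain ⟨h₁, h₂, h₃, h₄, h₅⟩ := mem_northEastTile.1 hp
    have hv : p 1 - p 0 ∈ Ioo (-n : ℝ) (-n + (2 * n + 1)) := ⟨h₂, by linarith⟩
    refine ⟨hv, ?_⟩
    rw [northEastProfile_eq hn (Ioo_subset_Ico_self hv),
      northEastProfile_add hn hj hjn (Ioo_subset_Ico_self hv), mem_Ioo, max_lt_iff, lt_max_iff,
      lt_min_iff]
    exact ⟨⟨h₁, by linarith⟩, h₅.imp_right fun h => ⟨h.1, by linarith [h.2]⟩⟩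
  · rw [northEastProfile_eq hn hv, northEastProfile_add hn hj hjn hv, mem_Icc, max_le_iff,
      le_max_iff, le_min_iff] at hu
    obtain ⟨⟨h₁, h₂⟩, h₃⟩ := hu
    exact (mem_closure_northEastTile hj hjn).2 ⟨h₁, hv.1, by linarith [hv.2], by linarith,
      h₃.imp_right fun h => ⟨h.1, by linarith [h.2]⟩⟩

end NorthEastTiling

section SouthWestTiling

theorem mem_halfTurn_iff {a : Pixel} {F : Set Plane} {p : Plane} :
    p ∈ halfTurn a F ↔ -p + emb a ∈ F := by
  refine ⟨?_, fun h => ⟨_, h, by simp⟩⟩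
  rintro ⟨q, hq, rfl⟩
  simpa using hq

theorem isOpen_halfTurn (a : Pixel) {F : Set Plane} (hF : IsOpen F) : IsOpen (halfTurn a F) :=
  ((Homeomorph.neg Plane).trans (Homeomorph.addRight (emb a))).isOpenMap F hF

theorem mem_closure_halfTurn_iff {a : Pixel} {F : Set Plane} {p : Plane} :
    p ∈ closure (halfTurn a F) ↔ -p + emb a ∈ closure F := by
  have h := ((Homeomorph.neg Plane).trans (Homeomorph.addRight (emb a))).image_closure F
  rw [← mem_halfTurn_iff]
  exact (Set.ext_iff.1 h p).symm

variable {n j : ℤ}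

theorem mem_halfTurn_southWestTile {p : Plane} : p ∈ halfTurn (n, n) (southWestTile n j) ↔
    n < p 0 + p 1 ∧ -(n : ℝ) < p 1 - p 0 ∧ p 1 - p 0 < n ∧
      (p 0 + p 1 < 3 * n - 1 ∧ p 0 < 2 * n - 1 ∨ p 0 + p 1 < 3 * n ∧ p 0 < n + j) := by
  simp only [mem_halfTurn_iff, mem_southWestTile, PiLp.add_apply, PiLp.neg_apply, emb_apply_zero,
    emb_apply_one]
  grind

theorem mem_closure_halfTurn_southWestTile (hj : 1 ≤ j) (hjn : j ≤ n) {p : Plane} :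
    p ∈ closure (halfTurn (n, n) (southWestTile n j)) ↔
      n ≤ p 0 + p 1 ∧ -(n : ℝ) ≤ p 1 - p 0 ∧ p 1 - p 0 ≤ n ∧
        (p 0 + p 1 ≤ 3 * n - 1 ∧ p 0 ≤ 2 * n - 1 ∨ p 0 + p 1 ≤ 3 * n ∧ p 0 ≤ n + j) := by
  simp only [mem_closure_halfTurn_iff, mem_closure_southWestTile hj hjn, PiLp.add_apply,
    PiLp.neg_apply, emb_apply_zero, emb_apply_one]
  grind

theorem disjoint_southWestTile_halfTurn :
    Disjoint (southWestTile n j) (halfTurn (n, n) (southWestTile n j)) :=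
  disjoint_left.2 fun _ hp hp' =>
    lt_asymm (mem_southWestTile.1 hp).1 (mem_halfTurn_southWestTile.1 hp').1

/-- The south-west boundary of `southWestTile n j` as a graph over `v = y - x` with height
`u = x + y`, continued to all `v` by the period of the tiling. -/
noncomputable def southWestProfile (j : ℤ) (hn : (0 : ℝ) < 2 * n) : ℝ → ℝ :=
  quasiExtension hn (-n) 2 fun v => min (max (-n + 1) (v - 2 * n + 2)) (max (-n) (v - 2 * j))

theorem southWestProfile_eq (hn : (0 : ℝ) < 2 * n) {v : ℝ} (hv : v ∈ Ico (-n : ℝ) (-n + 2 * n)) :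
    southWestProfile j hn v =
      min (max (-n + 1 : ℝ) (v - 2 * n + 2)) (max (-n : ℝ) (v - 2 * j)) :=
  quasiExtension_of_mem hn hv

theorem monotone_southWestProfile (hj : 1 ≤ j) (hjn : j ≤ n) (hn : (0 : ℝ) < 2 * n) :
    Monotone (southWestProfile j hn) := by
  have : (1 : ℝ) ≤ j := by exact_mod_cast hj
  have : (j : ℝ) ≤ n := by exact_mod_cast hjn
  refine monotone_quasiExtension hn zero_le_two (fun v w hvw => ?_) ?_
  · exact min_le_min (max_le_max le_rfl (by linarith)) (max_le_max le_rfl (by linarith))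
  · have h : (-n : ℝ) ≤ min (max (-n + 1 : ℝ) (-n - 2 * n + 2)) (max (-n : ℝ) (-n - 2 * j)) :=
      le_min (le_max_of_le_left (le_add_of_nonneg_right zero_le_one)) (le_max_left _ _)
    exact (min_le_left _ _).trans (max_le (by linarith) (by linarith))

theorem southWestProfile_add (hn : (0 : ℝ) < 2 * n) (hj : 1 ≤ j) (hjn : j ≤ n) {v : ℝ}
    (hv : v ∈ Ico (-n : ℝ) (-n + 2 * n)) :
    southWestProfile j hn (v + 2 * j) + (4 * n - 2) =
      max (min (3 * n - 1 : ℝ) (v + 4 * n - 2)) (min (3 * n) (v + 2 * n + 2 * j)) := by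
  have hjR : (1 : ℝ) ≤ j := by exact_mod_cast hj
  have hjnR : (j : ℝ) ≤ n := by exact_mod_cast hjn
  obtain ⟨hv₁, hv₂⟩ := hv
  rcases lt_or_ge (v + 2 * j) n with h | h
  · have hlt : j < n := by
      have : (j : ℝ) < n := by linarith
      exact_mod_cast this
    have hltR : (j : ℝ) + 1 ≤ n := by exact_mod_cast hlt
    rw [southWestProfile_eq hn ⟨by linarith, by linarith⟩,
      max_eq_right (a := (-n : ℝ)) (by linarith),
      min_eq_right (a := (3 * n : ℝ)) (by linarith), max_min_distrib_right,
      max_eq_left (a := v + 4 * n - 2) (by linarith), ← min_add_add_right, ← max_add_add_right]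
    ring_nf
  · have hmem : v + 2 * j - (1 : ℤ) * (2 * n) ∈ Ico (-n : ℝ) (-n + 2 * n) := by
      rw [Int.cast_one, one_mul]
      constructor <;> linarith
    rw [southWestProfile, quasiExtension_eq hn 1 hmem, Int.cast_one, one_mul,
      max_eq_left (a := (-n : ℝ)) (by linarith), min_eq_right (le_max_of_le_left (by linarith)),
      min_eq_left (a := (3 * n : ℝ)) (by linarith),
      max_eq_right ((min_le_left _ _).trans (by linarith))]
    ring

theorem tilesByLattice_southWestTile_union_halfTurn (hj : 1 ≤ j) (hjn : j ≤ n) :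
    TilesByLattice (southWestTile n j ∪ halfTurn (n, n) (southWestTile n j))
      (columnLattice !![n - 1, 2 * n - 1 + j; -n - 1, 2 * n - 1 - j]) := by
  have hjR : (1 : ℝ) ≤ j := by exact_mod_cast hj
  have hjnR : (j : ℝ) ≤ n := by exact_mod_cast hjn
  have hn : (0 : ℝ) < 2 * n := by linarith
  refine tilesByLattice_of_between hn (a := -n) (c := 2) (s := 2 * j) (W := 4 * n - 2) (by linarith)
    (by linarith) (monotone_southWestProfile hj hjn hn) (quasiExtension_add_mul hn) (by simp; ring)
    (by simp; ring) (by simp; ring) (by simp; ring)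
    (isOpen_southWestTile.union (isOpen_halfTurn _ isOpen_southWestTile)) (fun p hp => ?_)
    fun p hv hu => ?_
  · rw [mem_union, mem_southWestTile, mem_halfTurn_southWestTile] at hp
    have hv : p 1 - p 0 ∈ Ioo (-n : ℝ) (-n + 2 * n) := by
      rcases hp with ⟨-, h₁, h₂, -⟩ | ⟨-, h₁, h₂, -⟩ <;> exact ⟨h₁, by linarith⟩
    refine ⟨hv, ?_⟩
    rw [southWestProfile_eq hn (Ioo_subset_Ico_self hv),
      southWestProfile_add hn hj hjn (Ioo_subset_Ico_self hv), mem_Ioo, min_lt_iff, max_lt_iff,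
      max_lt_iff, lt_max_iff, lt_min_iff, lt_min_iff]
    obtain ⟨hv₁, hv₂⟩ := hv
    rcases hp with ⟨h, -, -, h'⟩ | ⟨h, -, -, h'⟩
    · refine ⟨h'.imp ?_ ?_, Or.inl ⟨by linarith, by linarith⟩⟩ <;>
        exact fun h' => ⟨h'.1, by linarith [h'.2]⟩
    · refine ⟨Or.inl ⟨by linarith, by linarith⟩, h'.imp ?_ ?_⟩ <;>
        exact fun h' => ⟨h'.1, by linarith [h'.2]⟩
  · rw [southWestProfile_eq hn hv, southWestProfile_add hn hj hjn hv, mem_Icc, min_le_iff,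
      max_le_iff, max_le_iff, le_max_iff, le_min_iff, le_min_iff] at hu
    rw [closure_union, mem_union, mem_closure_southWestTile hj hjn,
      mem_closure_halfTurn_southWestTile hj hjn]
    obtain ⟨hv₁, hv₂⟩ := hv
    refine (le_total (p 0 + p 1) n).imp (fun h => ⟨h, hv₁, by linarith, hu.1.imp ?_ ?_⟩)
      fun h => ⟨h, hv₁, by linarith, hu.2.imp ?_ ?_⟩ <;>
      exact fun h' => ⟨h'.1, by linarith [h'.2]⟩

end SouthWestTiling

section Hexagon

/-- The outer normals of the sides of `hexagon l n`, in clockwise order from the south-west side;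
side `k` joins the vertices `hexVertex l n k` and `hexVertex l n (k + 1)`. -/
def hexNormal : Fin 6 → Pixel := ![(-1, -1), (-1, 1), (0, 1), (1, 1), (1, 0), (1, -1)]

/-- The offsets of the sides of `hexagon l n`: side `k` lies on the line
`⟪hexNormal k, p⟫ = hexSupport l n k`. -/
def hexSupport (l n : ℤ) : Fin 6 → ℤ := ![n, n, l, 2 * l - n + 1, l, n]

/-- The hexagon that turns out to be the polygonal tile of Sieben's component `𝓓_{l,n}`. -/
def hexagon (l n : ℤ) : Set Plane := openPolygon hexNormal (hexSupport l n)

theorem mem_hexagon {l n : ℤ} {p : Plane} : p ∈ hexagon l n ↔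
    -(n : ℝ) < p 0 + p 1 ∧ p 1 - p 0 < n ∧ p 1 < l ∧ p 0 + p 1 < 2 * l - n + 1 ∧ p 0 < l ∧
      -(n : ℝ) < p 1 - p 0 := by
  simp only [hexagon, mem_openPolygon, hexNormal, hexSupport, Fin.forall_fin_succ,
    IsEmpty.forall_iff, and_true, Matrix.cons_val_zero, Matrix.cons_val_succ]
  push_cast
  grind

theorem isOpen_hexagon {l n : ℤ} : IsOpen (hexagon l n) := isOpen_openPolygon

theorem convex_hexagon {l n : ℤ} : Convex ℝ (hexagon l n) := convex_openPolygon

theorem nonempty_hexagon {l n : ℤ} (hl : 1 ≤ l) (hn : 2 ≤ n) : (hexagon l n).Nonempty := by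
  have hlR : (1 : ℝ) ≤ l := by exact_mod_cast hl
  have hnR : (2 : ℝ) ≤ n := by exact_mod_cast hn
  refine ⟨!₂[(1 - n) / 2, (1 - n) / 2], ?_⟩
  simp only [mem_hexagon, Matrix.cons_val_zero, Matrix.cons_val_one]
  refine ⟨?_, ?_, ?_, ?_, ?_, ?_⟩ <;> linarith

theorem mem_closure_hexagon {l n : ℤ} (hl : 1 ≤ l) (hn : 2 ≤ n) {p : Plane} :
    p ∈ closure (hexagon l n) ↔
      -(n : ℝ) ≤ p 0 + p 1 ∧ p 1 - p 0 ≤ n ∧ p 1 ≤ l ∧ p 0 + p 1 ≤ 2 * l - n + 1 ∧ p 0 ≤ l ∧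
        -(n : ℝ) ≤ p 1 - p 0 := by
  rw [hexagon, closure_openPolygon (nonempty_hexagon hl hn)]
  simp only [mem_closedPolygon, hexNormal, hexSupport, Fin.forall_fin_succ,
    IsEmpty.forall_iff, and_true, Matrix.cons_val_zero, Matrix.cons_val_succ]
  push_cast
  grind

theorem isBounded_hexagon {l n : ℤ} : Bornology.IsBounded (hexagon l n) := by
  refine isBounded_of_abs_apply_le (|(n : ℝ)| + |(l : ℝ)|) fun p hp => ?_
  rw [mem_hexagon] at hp
  have hn := le_abs_self (n : ℝ)
  have hl := le_abs_self (l : ℝ)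
  simp only [abs_le]
  refine ⟨⟨?_, ?_⟩, ?_, ?_⟩ <;> linarith [abs_nonneg (n : ℝ), abs_nonneg (l : ℝ)]

section Sieben

variable {l n : ℕ}

theorem mem_sitePerim_sieben (hl : 1 ≤ l) (hn : 2 ≤ n) (a b : ℤ) :
    (a, b) ∈ sitePerim (sieben l n) ↔
      -n ≤ a + b ∧ a + b ≤ 2 * l - n + 1 ∧ -n ≤ b - a ∧ b - a ≤ n ∧ a ≤ l ∧ b ≤ l ∧
        (a + b = -n ∨ a + b = 2 * l - n + 1 ∨ b - a = -n ∨ b - a = n) := by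
  rw [mem_sitePerim_iff]
  simp only [sieben, mem_ofPred_eq]
  omega

theorem extPerim_sieben (hl : 1 ≤ l) (hn : 2 ≤ n) :
    extPerim (sieben l n) = sitePerim (sieben l n) := by
  refine extPerim_eq_sitePerim ?_
  rintro ⟨a, b⟩ hz
  simp only [mem_sitePerim_sieben hl hn] at hz ⊢
  rcases hz.2.2.2.2.2.2 with h | h | h | h
  · exact ⟨(-1, 0), by simp [d4], by omega⟩
  · exact ⟨(1, 0), by simp [d4], by omega⟩
  · exact ⟨(0, -1), by simp [d4], by omega⟩
  · exact ⟨(0, 1), by simp [d4], by omega⟩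

theorem extCurve_sieben_subset (hl : 1 ≤ l) (hn : 2 ≤ n) :
    extCurve (sieben l n) ⊆ frontier (hexagon l n) := by
  have hne := nonempty_hexagon (l := l) (n := n) (by omega) (by omega)
  rw [← union_self (hexagon l n)]
  refine extCurve_subset_frontier_union_openPolygon hne hne ?_
  rintro ⟨a, b⟩ hp ⟨a', b'⟩ hq hpq
  simp only [mem_sitePerim_sieben hl hn, d8_eq_one_iff, abs_le] at hp hq hpq
  simp only [emb_mem_closedPolygon, hexNormal, hexSupport, Fin.forall_fin_succ,
    Fin.exists_fin_succ, IsEmpty.forall_iff, IsEmpty.exists_iff, and_true, or_false,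
    Matrix.cons_val_zero, Matrix.cons_val_succ]
  obtain ⟨p1, p2, p3, p4, _, p6, p7⟩ := hp
  obtain ⟨q1, q2, q3, q4, q5, q6, q7⟩ := hq
  refine ⟨by omega, ?_⟩
  rcases p7 with p7 | p7 | p7 | p7 <;> rcases q7 with q7 | q7 | q7 | q7 <;> omega

theorem frontier_hexagon_subset (hl : 1 ≤ l) (hn : 2 ≤ n) :
    frontier (hexagon l n) ⊆ extCurve (sieben l n) := by
  rintro x ⟨hx, hx'⟩
  rw [isOpen_hexagon.interior_eq, mem_hexagon] at hx'
  obtain ⟨hsw, hnw, htop, hne, hright, hse⟩ :=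
    (mem_closure_hexagon (by omega) (by omega)).1 hx
  push_cast at hx' hsw hnw htop hne hright hse
  have hside : x 0 + x 1 = -n ∨ x 1 - x 0 = n ∨ x 1 = l ∨ x 0 + x 1 = 2 * l - n + 1 ∨
      x 0 = l ∨ x 1 - x 0 = -n := by
    by_contra! hcon
    obtain ⟨c1, c2, c3, c4, c5, c6⟩ := hcon
    exact hx' ⟨hsw.lt_of_ne' c1, hnw.lt_of_ne c2, htop.lt_of_ne c3, hne.lt_of_ne c4,
      hright.lt_of_ne c5, hse.lt_of_ne' c6⟩
  have hrun (p d : Pixel) (m : ℤ) := mem_extCurve_of_run (extPerim_sieben hl hn)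
    (p := p) (d := d) (m := m) (x := x)
  simp only [mem_sitePerim_sieben hl hn] at hrun
  rcases hside with h | h | h | h | h | h
  · refine hrun (0, -n) (-1, 1) n (by simp [d8]) (by omega) (by omega) (-x 0) ?_ ?_ ?_ ?_ <;>
      push_cast <;> linarith
  · refine hrun (-n, 0) (1, 1) l (by simp [d8]) (by omega) (by omega) (x 1) ?_ ?_ ?_ ?_ <;>
      push_cast <;> linarith
  · refine hrun (l - n, l) (1, 0) 1 (by simp [d8]) (by omega) (by omega) (x 0 - (l - n))
      ?_ ?_ ?_ ?_ <;> push_cast <;> linarith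
  · refine hrun (l - n + 1, l) (1, -1) (n - 1) (by simp [d8]) (by omega) (by omega)
      (x 0 - (l - n + 1)) ?_ ?_ ?_ ?_ <;> push_cast <;> linarith
  · refine hrun (l, l - n) (0, 1) 1 (by simp [d8]) (by omega) (by omega) (x 1 - (l - n))
      ?_ ?_ ?_ ?_ <;> push_cast <;> linarith
  · refine hrun (0, -n) (1, 1) l (by simp [d8]) (by omega) (by omega) (x 0) ?_ ?_ ?_ ?_ <;>
      push_cast <;> linarith

theorem polygonalTile_sieben (hl : 1 ≤ l) (hn : 2 ≤ n) :
    polygonalTile (sieben l n) = hexagon l n := by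
  rw [← union_self (hexagon l n)]
  refine polygonalTile_eq_of_convex_union convex_hexagon convex_hexagon isOpen_hexagon
    isOpen_hexagon ((union_self (hexagon l n)).symm ▸ isBounded_hexagon :) ?_ fun z hz => ?_
  · rw [union_self]
    exact (extCurve_sieben_subset hl hn).antisymm (frontier_hexagon_subset hl hn)
  · rw [union_self, hexagon, emb_mem_openPolygon] at hz
    simp only [hexNormal, hexSupport, Fin.forall_fin_succ, IsEmpty.forall_iff, and_true,
      Matrix.cons_val_zero, Matrix.cons_val_succ] at hz
    simp only [sieben, mem_ofPred_eq]
    omega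

end Sieben

section Vertices

variable {l n : ℤ}

/-- The vertices of `hexagon l n` in clockwise order. The angles at vertices `0` and `1` are right,
the others equal `3π/4`. -/
noncomputable def hexVertex (l n : ℤ) (i : Fin 6) : Plane :=
  emb (![(0, -n), (-n, 0), (l - n, l), (l - n + 1, l), (l, l - n + 1), (l, l - n)] i)

theorem inner_hexVertex_le (hl : 1 ≤ l) (hn : 2 ≤ n) (k i : Fin 6) :
    inner ℝ (emb (hexNormal k)) (hexVertex l n i) ≤ hexSupport l n k := by
  rw [hexVertex, inner_emb, emb_apply_zero, emb_apply_one]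
  norm_cast
  fin_cases k <;> fin_cases i <;> simp [hexNormal, hexSupport] <;> omega

theorem inner_hexVertex_eq_iff (hl : 1 ≤ l) (hn : 2 ≤ n) (k i : Fin 6) :
    inner ℝ (emb (hexNormal k)) (hexVertex l n i) = hexSupport l n k ↔ i = k ∨ i = k + 1 := by
  rw [hexVertex, inner_emb, emb_apply_zero, emb_apply_one]
  norm_cast
  fin_cases k <;> fin_cases i <;> simp [hexNormal, hexSupport] <;> omega

theorem closure_hexagon (hl : 1 ≤ l) (hn : 2 ≤ n) :
    closure (hexagon l n) = closedPolygon hexNormal (hexSupport l n) :=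
  closure_openPolygon (nonempty_hexagon hl hn)

theorem hexVertex_mem_closure (hl : 1 ≤ l) (hn : 2 ≤ n) (i : Fin 6) :
    hexVertex l n i ∈ closure (hexagon l n) :=
  closure_hexagon hl hn ▸ fun k => inner_hexVertex_le hl hn k i

theorem convexIndependent_hexVertex (hl : 1 ≤ l) (hn : 2 ≤ n) :
    ConvexIndependent ℝ (hexVertex l n) := by
  rw [convexIndependent_iff_notMem_convexHull_sdiff]
  intro i s hmem
  -- Among the vertices, the sum of the normals of the two sides through `i` is maximal only at `i`.
  set f := innerSL ℝ (emb (hexNormal (i - 1)) + emb (hexNormal i)) with hf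
  have hval (k : Fin 6) : f (hexVertex l n k) =
      inner ℝ (emb (hexNormal (i - 1))) (hexVertex l n k) +
        inner ℝ (emb (hexNormal i)) (hexVertex l n k) := by
    simp only [hf, innerSL_apply_apply, inner_add_left]
  have hi : f (hexVertex l n i) = hexSupport l n (i - 1) + hexSupport l n i := by
    rw [hval, (inner_hexVertex_eq_iff hl hn _ _).2 (Or.inr (sub_add_cancel i 1).symm),
      (inner_hexVertex_eq_iff hl hn _ _).2 (Or.inl rfl)]
  have hlt : hexVertex l n '' (s \ {i}) ⊆ {x | f x < f (hexVertex l n i)} := by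
    rintro _ ⟨k, ⟨-, hk⟩, rfl⟩
    have hle := inner_hexVertex_le hl hn (i - 1) k
    have hle' := inner_hexVertex_le hl hn i k
    rw [mem_ofPred_eq, hi, hval]
    refine (add_le_add hle hle').lt_of_ne fun h => hk ?_
    obtain ⟨h, h'⟩ := (add_eq_add_iff_eq_and_eq hle hle').1 h
    rw [inner_hexVertex_eq_iff hl hn] at h h'
    rw [mem_singleton_iff]
    clear * - h h'
    decide +revert
  exact lt_irrefl (f _) (convexHull_min hlt (convex_halfSpace_lt f.toLinearMap.isLinear _) hmem)

theorem mem_segment_of_eq_add_smul {E : Type*} [AddCommGroup E] [Module ℝ E] {a b x d : E}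
    {s m : ℝ} (hs : 0 ≤ s) (hsm : s ≤ m) (hb : b = a + m • d) (hx : x = a + s • d) :
    x ∈ segment ℝ a b := by
  subst hb hx
  rcases (hs.trans hsm).eq_or_lt' with rfl | hm
  · rw [le_antisymm hsm hs]
    exact right_mem_segment ℝ _ _
  · refine segment_eq_image' ℝ a (a + m • d) ▸ ⟨s / m, ⟨by positivity, (div_le_one hm).2 hsm⟩, ?_⟩
    simp only [add_sub_cancel_left, smul_smul, div_mul_cancel₀ _ hm.ne']

theorem mem_segment_hexVertex (hl : 1 ≤ l) (hn : 2 ≤ n) {x : Plane} (hx : x ∈ closure (hexagon l n))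
    {k : Fin 6} (hk : inner ℝ (emb (hexNormal k)) x = hexSupport l n k) :
    x ∈ segment ℝ (hexVertex l n k) (hexVertex l n (k + 1)) := by
  rw [mem_closure_hexagon hl hn] at hx
  rw [inner_emb] at hk
  have hrun (d : Pixel) (s m : ℝ) := mem_segment_of_eq_add_smul (a := hexVertex l n k)
    (b := hexVertex l n (k + 1)) (x := x) (d := emb d) (s := s) (m := m)
  fin_cases k <;> simp only [hexNormal, hexSupport] at hk
  · refine hrun (-1, 1) (-x 0) n ?_ ?_ (plane_ext ?_ ?_) (plane_ext ?_ ?_) <;>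
      simp [hexVertex, emb] at hk ⊢ <;> linarith
  · refine hrun (1, 1) (x 1) l ?_ ?_ (plane_ext ?_ ?_) (plane_ext ?_ ?_) <;>
      simp [hexVertex, emb] at hk ⊢ <;> linarith
  · refine hrun (1, 0) (x 0 - (l - n)) 1 ?_ ?_ (plane_ext ?_ ?_) (plane_ext ?_ ?_) <;>
      simp [hexVertex, emb] at hk ⊢ <;> linarith
  · refine hrun (1, -1) (x 0 - (l - n + 1)) (n - 1) ?_ ?_ (plane_ext ?_ ?_) (plane_ext ?_ ?_) <;>
      simp [hexVertex, emb] at hk ⊢ <;> linarith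
  · refine hrun (0, -1) (l - n + 1 - x 1) 1 ?_ ?_ (plane_ext ?_ ?_) (plane_ext ?_ ?_) <;>
      simp [hexVertex, emb] at hk ⊢ <;> linarith
  · refine hrun (-1, -1) (l - x 0) l ?_ ?_ (plane_ext ?_ ?_) (plane_ext ?_ ?_) <;>
      simp [hexVertex, emb] at hk ⊢ <;> linarith

theorem exists_inner_eq_of_notMem_hexagon (hl : 1 ≤ l) (hn : 2 ≤ n) {x : Plane}
    (hx : x ∈ closure (hexagon l n)) (hx' : x ∉ hexagon l n) :
    ∃ k, inner ℝ (emb (hexNormal k)) x = hexSupport l n k := by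
  rw [closure_hexagon hl hn] at hx
  by_contra! hne
  exact hx' fun k => (hx k).lt_of_ne (hne k)

theorem convexHull_range_hexVertex (hl : 1 ≤ l) (hn : 2 ≤ n) :
    convexHull ℝ (range (hexVertex l n)) = closure (hexagon l n) := by
  have hconv : Convex ℝ (closure (hexagon l n)) := convex_openPolygon.closure
  refine Subset.antisymm
    (convexHull_min (range_subset_iff.2 (hexVertex_mem_closure hl hn)) hconv) ?_
  have hcompact : IsCompact (closure (hexagon l n)) := isBounded_hexagon.isCompact_closure
  rw [← closure_convexHull_extremePoints hcompact hconv]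
  refine closure_minimal (convexHull_min (fun x hx => ?_) (convex_convexHull ℝ _))
    ((finite_range _).isClosed_convexHull ℝ)
  have hx' : x ∉ hexagon l n := fun h => disjoint_left.1 (disjoint_interior_extremePoints _)
    (interior_maximal subset_closure isOpen_hexagon h) hx
  obtain ⟨k, hk⟩ := exists_inner_eq_of_notMem_hexagon hl hn hx.1 hx'
  exact segment_subset_convexHull (mem_range_self k) (mem_range_self (k + 1))
    (mem_segment_hexVertex hl hn hx.1 hk)

theorem isOpenConvexHexagon_hexagon (hl : 1 ≤ l) (hn : 2 ≤ n) :
    IsOpenConvexHexagon (hexagon l n) := by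
  refine ⟨hexVertex l n, convexIndependent_hexVertex hl hn, ?_⟩
  rw [convexHull_range_hexVertex hl hn,
    convex_hexagon.interior_closure_eq_interior_of_nonempty_interior,
    isOpen_hexagon.interior_eq]
  exact isOpen_hexagon.interior_eq.symm ▸ nonempty_hexagon hl hn

end Vertices

end Hexagon

section SolidAngle

open Filter Topology MeasureTheory Metric

variable {E : Type*} [NormedAddCommGroup E] [InnerProductSpace ℝ E] [FiniteDimensional ℝ E]

theorem inner_reflection_right (K : Submodule ℝ E) (u x : E) :
    inner ℝ u (K.reflection x) = inner ℝ (K.reflection u) x := by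
  rw [← K.reflection.inner_map_map, K.reflection_reflection]

variable [MeasurableSpace E] [BorelSpace E]

theorem volume_image_isometryEquiv (g : E ≃ᵢ E) (X : Set E) : volume (g '' X) = volume X := by
  rw [← InnerProductSpace.euclideanHausdorffMeasure_eq_volume]
  exact g.isometry.euclideanHausdorffMeasure_image X

/-- The solid angle of `X` at `p` is `θ`, measured as the fraction of a full turn: all sufficiently
small balls around `p` are filled by `X` in the exact proportion `θ`. -/
def HasSolidAngle (X : Set E) (p : E) (θ : ℝ) : Prop :=
  ∀ᶠ r in 𝓝[>] 0, volume.real (X ∩ ball p r) = θ * volume.real (ball p r)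

variable {X Y : Set E} {p v : E} {θ φ : ℝ}

theorem volume_real_ball_pos (p : E) {r : ℝ} (hr : 0 < r) : 0 < volume.real (ball p r) :=
  ENNReal.toReal_pos (measure_ball_pos volume p hr).ne' measure_ball_lt_top.ne

theorem HasSolidAngle.nonneg (h : HasSolidAngle X p θ) : 0 ≤ θ := by
  obtain ⟨r, hr, hr0⟩ := (h.and self_mem_nhdsWithin).exists
  exact nonneg_of_mul_nonneg_left (hr ▸ measureReal_nonneg) (volume_real_ball_pos p hr0)

theorem HasSolidAngle.unique (h : HasSolidAngle X p θ) (h' : HasSolidAngle X p φ) : θ = φ := by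
  obtain ⟨r, ⟨hr, hr'⟩, hr0⟩ := ((h.and h').and self_mem_nhdsWithin).exists
  exact mul_right_cancel₀ (volume_real_ball_pos p hr0).ne' (hr.symm.trans hr')

theorem hasSolidAngle_univ : HasSolidAngle univ p 1 :=
  Eventually.of_forall fun r => by rw [univ_inter, one_mul]

theorem hasSolidAngle_empty : HasSolidAngle ∅ p 0 :=
  Eventually.of_forall fun r => by rw [empty_inter, measureReal_empty, zero_mul]

theorem HasSolidAngle.congr (h : HasSolidAngle X p θ) (hXY : ∀ᶠ x in 𝓝 p, x ∈ X ↔ x ∈ Y) :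
    HasSolidAngle Y p θ := by
  obtain ⟨ε, hε, hball⟩ := Metric.eventually_nhds_iff_ball.1 hXY
  filter_upwards [h, Ioo_mem_nhdsGT hε] with r hr hrε
  rw [← hr]
  congr 1
  ext x
  simp only [mem_inter_iff, and_congr_left_iff]
  exact fun hx => (hball x (ball_subset_ball hrε.2.le hx)).symm

theorem hasSolidAngle_zero_of_notMem_closure (hp : p ∉ closure X) : HasSolidAngle X p 0 :=
  hasSolidAngle_empty.congr <| (isClosed_closure.isOpen_compl.eventually_mem hp).mono
    fun _ hx => iff_of_false (notMem_empty _) fun h => hx (subset_closure h)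

theorem hasSolidAngle_one_of_mem (hX : IsOpen X) (hp : p ∈ X) : HasSolidAngle X p 1 :=
  hasSolidAngle_univ.congr <| (hX.eventually_mem hp).mono
    fun _ hx => iff_of_true (mem_univ _) hx

theorem HasSolidAngle.mem_closure (h : HasSolidAngle X p θ) (hθ : θ ≠ 0) : p ∈ closure X := by
  by_contra hp
  exact hθ (h.unique (hasSolidAngle_zero_of_notMem_closure hp))

theorem HasSolidAngle.image (h : HasSolidAngle X p θ) (g : E ≃ᵢ E) :
    HasSolidAngle (g '' X) (g p) θ := by
  filter_upwards [h] with r hr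
  rw [← g.image_ball, ← image_inter g.injective, measureReal_def, measureReal_def,
    volume_image_isometryEquiv, volume_image_isometryEquiv]
  exact hr

theorem HasSolidAngle.sdiff (hX : HasSolidAngle X p θ) (hY : HasSolidAngle Y p φ) (hYX : Y ⊆ X)
    (hm : MeasurableSet Y) : HasSolidAngle (X \ Y) p (θ - φ) := by
  filter_upwards [hX, hY] with r hrX hrY
  have hfin : volume (X ∩ ball p r) ≠ ⊤ :=
    measure_ne_top_of_subset inter_subset_right measure_ball_lt_top.ne
  have hsplit := measureReal_inter_add_sdiff hm hfin
  rw [inter_right_comm, inter_eq_self_of_subset_right hYX, inter_sdiff_right_comm, hrX,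
    hrY] at hsplit
  rw [sub_mul]
  exact eq_sub_of_add_eq' hsplit

theorem hasSolidAngle_sub_mem (h : HasSolidAngle X 0 θ) (p : E) :
    HasSolidAngle {x | x - p ∈ X} p θ := by
  have := h.image (IsometryEquiv.addRight p)
  rw [IsometryEquiv.addRight_apply, zero_add] at this
  convert this using 1
  ext x
  exact ⟨fun hx => ⟨_, hx, sub_add_cancel x p⟩, by rintro ⟨y, hy, rfl⟩; simpa using hy⟩

theorem volume_orthogonal_eq_zero (hv : v ≠ 0) : volume {x : E | inner ℝ v x = 0} = 0 := by
  have hcoe : {x : E | inner ℝ v x = 0} = (ℝ ∙ v)ᗮ := by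
    ext x
    exact Submodule.mem_orthogonal_singleton_iff_inner_right.symm
  rw [hcoe]
  refine Measure.addHaar_submodule volume _ fun htop => hv ?_
  simpa using htop

theorem image_reflection_inter_halfSpace_ae_eq (hv : v ≠ 0)
    (hX : ∀ x ∈ X, (ℝ ∙ v)ᗮ.reflection x ∈ X) :
    (ℝ ∙ v)ᗮ.reflection '' (X ∩ {x | inner ℝ v x < 0}) =ᵐ[volume]
      (X \ {x | inner ℝ v x < 0} : Set E) := by
  have hneg (x : E) : inner ℝ v ((ℝ ∙ v)ᗮ.reflection x) = -inner ℝ v x := by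
    rw [inner_reflection_right, Submodule.reflection_orthogonalComplement_singleton_eq_neg,
      inner_neg_left]
  refine (LE.le.eventuallyLE ?_).antisymm
    (ae_le_set.2 (measure_mono_null ?_ (volume_orthogonal_eq_zero hv)))
  · rintro _ ⟨x, ⟨hx, hlt⟩, rfl⟩
    exact ⟨hX x hx, by simpa only [mem_ofPred_eq, hneg, neg_lt_zero, not_lt] using le_of_lt hlt⟩
  · rintro x ⟨⟨hx, hpos⟩, hx'⟩
    by_contra hne
    refine hx' ⟨_, ⟨hX x hx, ?_⟩, Submodule.reflection_reflection _ x⟩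
    simpa only [mem_ofPred_eq, hneg, neg_lt_zero] using (not_lt.1 hpos).lt_of_ne' hne

theorem HasSolidAngle.inter_halfSpace (h : HasSolidAngle X 0 θ) (hv : v ≠ 0)
    (hX : ∀ x ∈ X, (ℝ ∙ v)ᗮ.reflection x ∈ X) :
    HasSolidAngle (X ∩ {x | inner ℝ v x < 0}) 0 (θ / 2) := by
  have hm : MeasurableSet {x : E | inner ℝ v x < 0} :=
    (isOpen_lt (by fun_prop) continuous_const).measurableSet
  filter_upwards [h] with r hr
  have hA : ∀ x ∈ X ∩ ball 0 r, (ℝ ∙ v)ᗮ.reflection x ∈ X ∩ ball 0 r := fun x hx =>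
    ⟨hX x hx.1, by simpa only [mem_ball_zero_iff, LinearIsometryEquiv.norm_map] using hx.2⟩
  have hfin : volume (X ∩ ball 0 r) ≠ ⊤ :=
    measure_ne_top_of_subset inter_subset_right measure_ball_lt_top.ne
  have hsplit := measureReal_inter_add_sdiff hm hfin
  have hhalf : volume.real (X ∩ ball 0 r ∩ {x | inner ℝ v x < 0}) =
      volume.real ((X ∩ ball 0 r) \ {x | inner ℝ v x < 0}) := by
    rw [← measureReal_congr (image_reflection_inter_halfSpace_ae_eq hv hA)]
    exact congrArg ENNReal.toReal
      (volume_image_isometryEquiv (ℝ ∙ v)ᗮ.reflection.toIsometryEquiv _).symm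
  rw [← hhalf, hr] at hsplit
  rw [inter_right_comm]
  linarith

section Cones

variable {u w : E}

theorem hasSolidAngle_halfSpace (hu : u ≠ 0) : HasSolidAngle {x | inner ℝ u x < 0} 0 (1 / 2) := by
  have := hasSolidAngle_univ.inter_halfSpace hu fun x _ => mem_univ _
  rwa [univ_inter] at this

theorem hasSolidAngle_quadrant (hu : u ≠ 0) (hw : w ≠ 0) (huw : inner ℝ u w = 0) :
    HasSolidAngle ({x | inner ℝ u x < 0} ∩ {x | inner ℝ w x < 0}) 0 (1 / 4) := by
  have hfix : (ℝ ∙ w)ᗮ.reflection u = u := Submodule.reflection_mem_subspace_eq_self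
    (Submodule.mem_orthogonal_singleton_iff_inner_left.2 huw)
  have := (hasSolidAngle_halfSpace hu).inter_halfSpace hw fun x hx => by
    rwa [mem_ofPred_eq, inner_reflection_right, hfix]
  rwa [show (1 / 2 / 2 : ℝ) = 1 / 4 by norm_num] at this

theorem hasSolidAngle_octant (hu : u ≠ 0) (hnorm : ‖u‖ = ‖w‖) (huw : inner ℝ u w = 0) :
    HasSolidAngle ({x | inner ℝ u x < 0} ∩ {x | inner ℝ w x < 0} ∩ {x | inner ℝ (u - w) x < 0}) 0
      (1 / 8) := by
  have hw : w ≠ 0 := by rwa [← norm_ne_zero_iff, ← hnorm, norm_ne_zero_iff]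
  have hne : u - w ≠ 0 := by
    rw [sub_ne_zero]
    rintro rfl
    exact hu (inner_self_eq_zero.1 huw)
  have huw' := Submodule.reflection_sub hnorm
  have hwu : (ℝ ∙ (u - w))ᗮ.reflection w = u := by
    simpa only [Submodule.reflection_reflection] using
      (congrArg (ℝ ∙ (u - w))ᗮ.reflection huw').symm
  have := (hasSolidAngle_quadrant hu hw huw).inter_halfSpace hne fun x hx => by
    simp only [mem_inter_iff, mem_ofPred_eq, inner_reflection_right, huw', hwu]
    exact hx.symm
  rwa [show (1 / 4 / 2 : ℝ) = 1 / 8 by norm_num] at this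

theorem hasSolidAngle_obtuse (hu : u ≠ 0) (hnorm : ‖u‖ = ‖w‖) (huw : inner ℝ u w = 0) :
    HasSolidAngle ({x | inner ℝ u x < 0} ∩ {x | inner ℝ (u - w) x < 0}) 0 (3 / 8) := by
  have hset : {x | inner ℝ u x < 0} ∩ {x | inner ℝ (u - w) x < 0} = {x | inner ℝ u x < 0} \
      (({x | inner ℝ u x < 0} ∩ {x | inner ℝ w x < 0}) \
        ({x | inner ℝ u x < 0} ∩ {x | inner ℝ w x < 0} ∩ {x | inner ℝ (u - w) x < 0})) := by
    ext x
    simp only [mem_inter_iff, Set.mem_sdiff, mem_ofPred_eq, inner_sub_left]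
    grind
  have hw : w ≠ 0 := by rwa [← norm_ne_zero_iff, ← hnorm, norm_ne_zero_iff]
  have hm (v : E) : MeasurableSet {x : E | inner ℝ v x < 0} :=
    (isOpen_lt (by fun_prop) continuous_const).measurableSet
  have hQ := MeasurableSet.inter (hm u) (hm w)
  have hO := MeasurableSet.inter hQ (hm (u - w))
  have := (hasSolidAngle_halfSpace hu).sdiff ((hasSolidAngle_quadrant hu hw huw).sdiff
    (hasSolidAngle_octant hu hnorm huw) inter_subset_left hO)
    (sdiff_subset.trans inter_subset_left) (MeasurableSet.diff hQ hO)
  rwa [← hset, show (1 / 2 - (1 / 4 - 1 / 8) : ℝ) = 3 / 8 by norm_num] at this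

end Cones

end SolidAngle

section HexagonAngles

open Filter Topology

theorem eventually_mem_openPolygon_iff {ι : Type*} [Finite ι] {ν : ι → Pixel} {c : ι → ℤ}
    {p : Plane} (hp : p ∈ closedPolygon ν c) : ∀ᶠ x in 𝓝 p, x ∈ openPolygon ν c ↔
      ∀ i, inner ℝ (emb (ν i)) p = c i → inner ℝ (emb (ν i)) (x - p) < 0 := by
  have hinactive : ∀ᶠ x in 𝓝 p, ∀ i, inner ℝ (emb (ν i)) p < c i → inner ℝ (emb (ν i)) x < c i :=
    eventually_all.2 fun i => eventually_imp_distrib_left.2 fun hi =>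
      (isOpen_lt (by fun_prop) continuous_const).mem_nhds hi
  filter_upwards [hinactive] with x hx
  simp only [inner_sub_right, sub_neg]
  exact ⟨fun h i hi => hi ▸ h i, fun h i => (hp i).eq_or_lt.elim (fun hi => hi ▸ h i hi) (hx i)⟩

theorem hasSolidAngle_openPolygon {ι : Type*} [Finite ι] {ν : ι → Pixel} {c : ι → ℤ}
    {p : Plane} {θ : ℝ} (hp : p ∈ closedPolygon ν c) (hcone : HasSolidAngle
      {y : Plane | ∀ i, inner ℝ (emb (ν i)) p = c i → inner ℝ (emb (ν i)) y < 0} 0 θ) :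
    HasSolidAngle (openPolygon ν c) p θ :=
  (hasSolidAngle_sub_mem hcone p).congr <|
    (eventually_mem_openPolygon_iff hp).mono fun _ h => h.symm

variable {l n : ℤ}

theorem hexVertex_mem_closedPolygon (hl : 1 ≤ l) (hn : 2 ≤ n) (i : Fin 6) :
    hexVertex l n i ∈ closedPolygon hexNormal (hexSupport l n) :=
  fun k => inner_hexVertex_le hl hn k i

theorem openSegment_hexVertex_subset (hl : 1 ≤ l) (hn : 2 ≤ n) (k : Fin 6) :
    openSegment ℝ (hexVertex l n k) (hexVertex l n (k + 1)) ⊆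
      closedPolygon hexNormal (hexSupport l n) :=
  (openSegment_subset_segment ℝ _ _).trans <| convex_closedPolygon.segment_subset
    (hexVertex_mem_closedPolygon hl hn k) (hexVertex_mem_closedPolygon hl hn (k + 1))

theorem inner_eq_iff_of_mem_openSegment_hexVertex (hl : 1 ≤ l) (hn : 2 ≤ n) {k : Fin 6} {x : Plane}
    (hx : x ∈ openSegment ℝ (hexVertex l n k) (hexVertex l n (k + 1))) (i : Fin 6) :
    inner ℝ (emb (hexNormal i)) x = hexSupport l n i ↔ i = k := by
  obtain ⟨a, b, ha, hb, hab, rfl⟩ := hx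
  have hik : i = k ↔ (k = i ∨ k = i + 1) ∧ (k + 1 = i ∨ k + 1 = i + 1) := by decide +revert
  have h₁ := inner_hexVertex_le hl hn i k
  have h₂ := inner_hexVertex_le hl hn i (k + 1)
  have hc : (hexSupport l n i : ℝ) = a * hexSupport l n i + b * hexSupport l n i := by
    rw [← add_mul, hab, one_mul]
  rw [inner_add_right, inner_smul_right, inner_smul_right]
  nth_rw 1 [hc]
  rw [add_eq_add_iff_eq_and_eq
      (mul_le_mul_of_nonneg_left h₁ ha.le) (mul_le_mul_of_nonneg_left h₂ hb.le),
    mul_right_inj' ha.ne', mul_right_inj' hb.ne', inner_hexVertex_eq_iff hl hn,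
    inner_hexVertex_eq_iff hl hn, ← hik]

theorem hexNormal_ne_zero (k : Fin 6) : hexNormal k ≠ 0 := by decide +revert

theorem hasSolidAngle_hexagon_side (hl : 1 ≤ l) (hn : 2 ≤ n) {k : Fin 6} {x : Plane}
    (hx : x ∈ openSegment ℝ (hexVertex l n k) (hexVertex l n (k + 1))) :
    HasSolidAngle (hexagon l n) x (1 / 2) := by
  refine hasSolidAngle_openPolygon (openSegment_hexVertex_subset hl hn k hx) ?_
  simp only [inner_eq_iff_of_mem_openSegment_hexVertex hl hn hx, forall_eq]
  exact hasSolidAngle_halfSpace (emb_ne_zero (hexNormal_ne_zero k))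

/-- The angle of `hexagon l n` at `hexVertex l n i`, as a fraction of a full turn. -/
noncomputable def hexAngle : Fin 6 → ℝ := ![1 / 4, 1 / 4, 3 / 8, 3 / 8, 3 / 8, 3 / 8]

theorem hasSolidAngle_hexVertex (hl : 1 ≤ l) (hn : 2 ≤ n) (i : Fin 6) :
    HasSolidAngle (hexagon l n) (hexVertex l n i) (hexAngle i) := by
  refine hasSolidAngle_openPolygon (hexVertex_mem_closedPolygon hl hn i) ?_
  have hcone : {y : Plane | ∀ k, inner ℝ (emb (hexNormal k)) (hexVertex l n i) = hexSupport l n k →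
      inner ℝ (emb (hexNormal k)) y < 0} = {y | inner ℝ (emb (hexNormal i)) y < 0} ∩
        {y | inner ℝ (emb (hexNormal (i - 1))) y < 0} := by
    ext y
    have hk (k : Fin 6) : i = k ∨ i = k + 1 ↔ k = i ∨ k = i - 1 := by decide +revert
    simp only [inner_hexVertex_eq_iff hl hn, hk, forall_eq_or_imp, forall_eq, mem_inter_iff,
      mem_ofPred_eq]
  rw [hcone]
  have hright {u w : Pixel} (hu : u ≠ 0) (hw : w ≠ 0) (h : u.1 * w.1 + u.2 * w.2 = 0) :
      HasSolidAngle ({y | inner ℝ (emb u) y < 0} ∩ {y | inner ℝ (emb w) y < 0}) 0 (1 / 4) :=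
    hasSolidAngle_quadrant (emb_ne_zero hu) (emb_ne_zero hw)
      (by rw [inner_emb_emb, h, Int.cast_zero])
  have hobtuse {u v : Pixel} (hu : u ≠ 0) (h : u.1 * (u - v).1 + u.2 * (u - v).2 = 0)
      (h' : u.1 * u.1 + u.2 * u.2 = (u - v).1 * (u - v).1 + (u - v).2 * (u - v).2) :
      HasSolidAngle ({y | inner ℝ (emb u) y < 0} ∩ {y | inner ℝ (emb v) y < 0}) 0 (3 / 8) := by
    have hnorm : ‖emb u‖ = ‖emb (u - v)‖ := by
      rw [norm_eq_sqrt_real_inner, norm_eq_sqrt_real_inner, inner_emb_emb, inner_emb_emb, h']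
    simpa only [emb_sub, sub_sub_cancel] using hasSolidAngle_obtuse (emb_ne_zero hu) hnorm
      (by rw [inner_emb_emb, h, Int.cast_zero])
  fin_cases i
  · exact hright (u := (-1, -1)) (w := (1, -1)) (by decide) (by decide) (by decide)
  · exact hright (u := (-1, 1)) (w := (-1, -1)) (by decide) (by decide) (by decide)
  · exact hobtuse (u := (0, 1)) (v := (-1, 1)) (by decide) (by decide) (by decide)
  · exact inter_comm _ _ ▸ hobtuse (u := (0, 1)) (v := (1, 1)) (by decide) (by decide) (by decide)
  · exact hobtuse (u := (1, 0)) (v := (1, 1)) (by decide) (by decide) (by decide)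
  · exact inter_comm _ _ ▸ hobtuse (u := (1, 0)) (v := (1, -1)) (by decide) (by decide) (by decide)

end HexagonAngles

section Tilings

open TopologicalSpace

variable {E : Type*} [PseudoMetricSpace E] {F : Set E} {S : Set (E ≃ᵢ E)}

theorem isOpen_image (hF : IsOpen F) (g : E ≃ᵢ E) : IsOpen (g '' F) :=
  g.toHomeomorph.isOpenMap F hF

theorem image_closure (F : Set E) (g : E ≃ᵢ E) : g '' closure F = closure (g '' F) :=
  g.toHomeomorph.image_closure F

/-- The copies `g '' closure F`, `g ∈ S`, cover the space without overlap. -/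
structure IsTiling (F : Set E) (S : Set (E ≃ᵢ E)) : Prop where
  iUnion_eq : ⋃ g ∈ S, g '' closure F = univ
  disjoint : Pairwise fun g h : S => Disjoint (g.1 '' F) (h.1 '' F)

theorem IsTiling.exists_mem_closure (hS : IsTiling F S) (x : E) :
    ∃ g : S, x ∈ closure (g.1 '' F) := by
  have hx : x ∈ ⋃ g ∈ S, g '' closure F := hS.iUnion_eq ▸ mem_univ x
  obtain ⟨g, hg, hxg⟩ := mem_iUnion₂.1 hx
  exact ⟨⟨g, hg⟩, image_closure F g ▸ hxg⟩

theorem IsTiling.countable [SeparableSpace E] (hS : IsTiling F S) (hF : IsOpen F)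
    (hne : F.Nonempty) : S.Countable := by
  have hpd : (univ : Set S).PairwiseDisjoint fun g : S => g.1 '' F :=
    fun g _ h _ hgh => hS.disjoint hgh
  exact countable_coe_iff.1 <| countable_univ_iff.1 <|
    hpd.countable_of_isOpen (fun g _ => isOpen_image hF g.1) fun g _ => hne.image g.1

theorem exists_isTiling_refl_mem {F : Set Plane} (h : TilesPlane F) :
    ∃ S : Set (Plane ≃ᵢ Plane), IsometryEquiv.refl Plane ∈ S ∧ IsTiling F S := by
  obtain ⟨S, hcov, hdisj⟩ := h
  have h0 : (0 : Plane) ∈ ⋃ g ∈ S, g '' closure F := hcov ▸ mem_univ _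
  obtain ⟨g₀, hg₀, -⟩ := mem_iUnion₂.1 h0
  refine ⟨(fun g => g.trans g₀.symm) '' S, ⟨g₀, hg₀, IsometryEquiv.ext g₀.symm_apply_apply⟩, ?_, ?_⟩
  · refine eq_univ_of_forall fun x => ?_
    have hx : g₀ x ∈ ⋃ g ∈ S, g '' closure F := hcov ▸ mem_univ _
    obtain ⟨g, hg, y, hy, hyx⟩ := mem_iUnion₂.1 hx
    exact mem_iUnion₂.2 ⟨_, mem_image_of_mem _ hg, y, hy, (g₀.symm_apply_eq.2 hyx)⟩
  · rintro ⟨_, g, hg, rfl⟩ ⟨_, h, hh, rfl⟩ hgh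
    have hne : g ≠ h := fun e => hgh (Subtype.ext (congrArg (·.trans g₀.symm) e))
    change Disjoint ((g₀.symm ∘ g) '' F) ((g₀.symm ∘ h) '' F)
    rw [image_comp, image_comp]
    exact (disjoint_image_iff g₀.symm.injective).2 (hdisj g hg h hh hne)

end Tilings

section AngleSum

open Filter Topology MeasureTheory Metric

variable {E : Type*} [NormedAddCommGroup E] [InnerProductSpace ℝ E] [FiniteDimensional ℝ E]
  [MeasurableSpace E] [BorelSpace E] {F : Set E} {S : Set (E ≃ᵢ E)} {p : E}

theorem IsTiling.finite_inter_ball (hS : IsTiling F S) (hF : IsOpen F) (hne : F.Nonempty)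
    (hb : Bornology.IsBounded F) (p : E) (r : ℝ) :
    {g : S | (g.1 '' F ∩ ball p r).Nonempty}.Finite := by
  have hsub : ⋃ g : {g : S | (g.1 '' F ∩ ball p r).Nonempty}, g.1.1 '' F ⊆ ball p (diam F + r) := by
    refine iUnion_subset ?_
    rintro ⟨g, _, ⟨y, hy, rfl⟩, hyp⟩ _ ⟨x, hx, rfl⟩
    have hdist := g.1.dist_eq x y ▸ dist_le_diam_of_mem hb hx hy
    exact (dist_triangle _ _ _).trans_lt (add_lt_add_of_le_of_lt hdist hyp)
  have hfin := Measure.finite_const_le_meas_of_disjoint_iUnion volume (hF.measure_pos volume hne)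
    (fun g : {g : S | (g.1 '' F ∩ ball p r).Nonempty} => (isOpen_image hF g.1.1).measurableSet)
    (fun g h hgh => hS.disjoint (Subtype.coe_injective.ne hgh))
    (measure_ne_top_of_subset hsub measure_ball_lt_top.ne)
  simp only [volume_image_isometryEquiv, le_refl, ofPred_true] at hfin
  exact finite_coe_iff.1 (finite_univ_iff.1 hfin)

theorem IsTiling.sum_volume_inter_ball (hS : IsTiling F S) (hF : IsOpen F)
    (hfr : volume (frontier F) = 0) {r : ℝ} {T : Finset S}
    (hT : ∀ g : S, (g.1 '' F ∩ ball p r).Nonempty → g ∈ T) :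
    ∑ g ∈ T, volume.real (g.1 '' F ∩ ball p r) = volume.real (ball p r) := by
  rw [← measureReal_biUnion_finset
    (fun g _ h _ hgh => (hS.disjoint hgh).mono inter_subset_left inter_subset_left)
    (fun g _ => ((isOpen_image hF g.1).inter isOpen_ball).measurableSet)
    fun g _ => measure_ne_top_of_subset inter_subset_right measure_ball_lt_top.ne]
  have hnull : volume (⋃ g ∈ T, frontier (g.1 '' F)) = 0 := by
    refine (measure_biUnion_null_iff T.countable_toSet).2 fun g _ => ?_
    have himage : g.1 '' frontier F = frontier (g.1 '' F) := g.1.toHomeomorph.image_frontier F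
    rw [← himage, volume_image_isometryEquiv, hfr]
  refine measureReal_congr ((iUnion₂_subset fun g _ => inter_subset_right).eventuallyLE.antisymm
    (ae_le_set.2 (measure_mono_null ?_ hnull)))
  rintro x ⟨hx, hx'⟩
  obtain ⟨g, hxg⟩ := hS.exists_mem_closure x
  obtain ⟨y, hy, hyg⟩ := mem_closure_iff.1 hxg _ isOpen_ball hx
  have hgT := hT g ⟨y, hyg, hy⟩
  refine mem_iUnion₂.2 ⟨g, hgT, hxg, fun h => hx' (mem_iUnion₂.2 ⟨g, hgT, ?_, hx⟩)⟩
  rwa [(isOpen_image hF g.1).interior_eq] at h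

theorem IsTiling.hasSum_solidAngle (hS : IsTiling F S) (hF : IsOpen F) (hne : F.Nonempty)
    (hb : Bornology.IsBounded F) (hfr : volume (frontier F) = 0) {θ : S → ℝ}
    (hθ : ∀ g : S, HasSolidAngle (g.1 '' F) p (θ g)) : HasSum θ 1 := by
  classical
  set T := (hS.finite_inter_ball hF hne hb p 1).toFinset with hTdef
  have hT (g : S) : g ∈ T ↔ (g.1 '' F ∩ ball p 1).Nonempty := by
    rw [hTdef, Finite.mem_toFinset, mem_ofPred_eq]
  have hsum : ∑ g ∈ T, θ g = 1 := by
    have hev : ∀ᶠ r in 𝓝[>] (0 : ℝ), ∀ g ∈ T,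
        volume.real (g.1 '' F ∩ ball p r) = θ g * volume.real (ball p r) :=
      (eventually_all_finset T).2 fun g _ => hθ g
    obtain ⟨r, hr, hr0, hr1⟩ := (hev.and (Ioc_mem_nhdsGT one_pos)).exists
    refine mul_right_cancel₀ (volume_real_ball_pos p hr0).ne' ?_
    rw [Finset.sum_mul, one_mul, ← Finset.sum_congr rfl hr]
    exact hS.sum_volume_inter_ball hF hfr fun g hg =>
      (hT g).2 (hg.mono (inter_subset_inter_right _ (ball_subset_ball hr1)))
  rw [← hsum]
  refine hasSum_sum_of_ne_finset_zero fun g hg => ?_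
  have hp : p ∉ closure (g.1 '' F) := fun hp => hg <| (hT g).2 <|
    inter_comm _ _ ▸ mem_closure_iff.1 hp _ isOpen_ball (mem_ball_self one_pos)
  exact (hθ g).unique (hasSolidAngle_zero_of_notMem_closure hp)

theorem exists_pos_le_sub_of_hasSum {ι : Type*} {a : ι → ℝ} {c : ℝ} (ha : ∀ i, 0 ≤ a i)
    (h : HasSum a c) {s : Finset ι} (hs : ∑ i ∈ s, a i < c) :
    ∃ i ∉ s, 0 < a i ∧ a i ≤ c - ∑ i ∈ s, a i := by
  classical
  by_contra! hle
  refine hs.ne ((hasSum_sum_of_ne_finset_zero fun i hi => ?_).unique h)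
  refine ((ha i).eq_or_lt.resolve_right fun hpos => ?_).symm
  have := sum_le_hasSum (insert i s) (fun j _ => ha j) h
  rw [Finset.sum_insert hi] at this
  linarith [hle i hi hpos]

end AngleSum

section HexagonTiling

open MeasureTheory

variable {l n : ℤ} {S : Set (Plane ≃ᵢ Plane)} {p : Plane}

theorem mem_hexagon_or_eq_hexVertex_or_mem_openSegment (hl : 1 ≤ l) (hn : 2 ≤ n)
    (hp : p ∈ closure (hexagon l n)) : p ∈ hexagon l n ∨ (∃ k, hexVertex l n k = p) ∨
      ∃ k, p ∈ openSegment ℝ (hexVertex l n k) (hexVertex l n (k + 1)) := by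
  refine or_iff_not_imp_left.2 fun hp' => ?_
  obtain ⟨k, hk⟩ := exists_inner_eq_of_notMem_hexagon hl hn hp hp'
  have hseg := mem_segment_hexVertex hl hn hp hk
  rw [← insert_endpoints_openSegment] at hseg
  rcases hseg with rfl | rfl | hseg
  exacts [Or.inl ⟨_, rfl⟩, Or.inl ⟨_, rfl⟩, Or.inr ⟨k, hseg⟩]

theorem hexAngle_eq (k : Fin 6) : hexAngle k = 1 / 4 ∨ hexAngle k = 3 / 8 := by
  fin_cases k <;> simp [hexAngle]

theorem exists_hasSolidAngle_hexagon (hl : 1 ≤ l) (hn : 2 ≤ n) (p : Plane) :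
    ∃ θ, HasSolidAngle (hexagon l n) p θ ∧ (θ = 0 ∨ 1 / 4 ≤ θ) := by
  by_cases hp : p ∈ closure (hexagon l n)
  · rcases mem_hexagon_or_eq_hexVertex_or_mem_openSegment hl hn hp with h | ⟨k, rfl⟩ | ⟨k, h⟩
    · exact ⟨1, hasSolidAngle_one_of_mem isOpen_hexagon h, by norm_num⟩
    · refine ⟨_, hasSolidAngle_hexVertex hl hn k, Or.inr ?_⟩
      rcases hexAngle_eq k with h | h <;> rw [h]
      norm_num
    · exact ⟨_, hasSolidAngle_hexagon_side hl hn h, by norm_num⟩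
  · exact ⟨0, hasSolidAngle_zero_of_notMem_closure hp, Or.inl rfl⟩

theorem IsTiling.exists_hasSum_angles (hl : 1 ≤ l) (hn : 2 ≤ n) (hS : IsTiling (hexagon l n) S)
    (p : Plane) : ∃ θ : S → ℝ, (∀ g : S, HasSolidAngle (g.1 '' hexagon l n) p (θ g)) ∧
      (∀ g, θ g = 0 ∨ 1 / 4 ≤ θ g) ∧ HasSum θ 1 := by
  have h (g : S) : ∃ θ, HasSolidAngle (g.1 '' hexagon l n) p θ ∧ (θ = 0 ∨ 1 / 4 ≤ θ) := by
    obtain ⟨θ, hθ, hθ'⟩ := exists_hasSolidAngle_hexagon hl hn (g.1.symm p)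
    exact ⟨θ, g.1.apply_symm_apply p ▸ hθ.image g.1, hθ'⟩
  choose θ hθ hθ' using h
  exact ⟨θ, hθ, hθ', hS.hasSum_solidAngle isOpen_hexagon (nonempty_hexagon hl hn) isBounded_hexagon
    (convex_hexagon.addHaar_frontier volume) hθ⟩

theorem IsTiling.exists_ne_of_half (hl : 1 ≤ l) (hn : 2 ≤ n) (hS : IsTiling (hexagon l n) S)
    {g : S} (hg : HasSolidAngle (g.1 '' hexagon l n) p (1 / 2)) :
    ∃ h : S, h ≠ g ∧ p ∈ closure (h.1 '' hexagon l n) ∧ p ∉ h.1 '' hexagon l n := by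
  obtain ⟨θ, hθ, -, hsum⟩ := hS.exists_hasSum_angles hl hn p
  have hθg := (hθ g).unique hg
  obtain ⟨h, hhg, hpos, hle⟩ := exists_pos_le_sub_of_hasSum (fun g => (hθ g).nonneg) hsum
    (s := {g}) (by rw [Finset.sum_singleton, hθg]; norm_num)
  rw [Finset.sum_singleton, hθg] at hle
  refine ⟨h, Finset.notMem_singleton.1 hhg, (hθ h).mem_closure hpos.ne', fun hp => ?_⟩
  have := (hθ h).unique (hasSolidAngle_one_of_mem (isOpen_image isOpen_hexagon h.1) hp)
  linarith

theorem IsTiling.eq_of_half_of_obtuse (hl : 1 ≤ l) (hn : 2 ≤ n) (hS : IsTiling (hexagon l n) S)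
    {g h : S} (hg : HasSolidAngle (g.1 '' hexagon l n) p (1 / 2))
    (hh : HasSolidAngle (h.1 '' hexagon l n) p (3 / 8)) : g = h := by
  classical
  by_contra hgh
  obtain ⟨θ, hθ, hθ', hsum⟩ := hS.exists_hasSum_angles hl hn p
  have hpair : ∑ i ∈ {g, h}, θ i = 7 / 8 := by
    rw [Finset.sum_pair hgh, (hθ g).unique hg, (hθ h).unique hh]
    norm_num
  obtain ⟨k, -, hpos, hle⟩ := exists_pos_le_sub_of_hasSum (fun g => (hθ g).nonneg) hsum
    (s := {g, h}) (by rw [hpair]; norm_num)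
  rw [hpair] at hle
  rcases hθ' k with h | h <;> linarith

theorem IsTiling.not_three_obtuse (hl : 1 ≤ l) (hn : 2 ≤ n) (hS : IsTiling (hexagon l n) S)
    {g h k : S} (hgh : g ≠ h) (hgk : g ≠ k) (hhk : h ≠ k)
    (hg : HasSolidAngle (g.1 '' hexagon l n) p (3 / 8))
    (hh : HasSolidAngle (h.1 '' hexagon l n) p (3 / 8)) :
    ¬HasSolidAngle (k.1 '' hexagon l n) p (3 / 8) := by
  classical
  intro hk
  obtain ⟨θ, hθ, -, hsum⟩ := hS.exists_hasSum_angles hl hn p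
  have hle := sum_le_hasSum {g, h, k} (fun i _ => (hθ i).nonneg) hsum
  rw [Finset.sum_insert (by simp only [Finset.mem_insert, Finset.mem_singleton, hgh, hgk, or_self,
    not_false_eq_true]), Finset.sum_pair hhk, (hθ g).unique hg, (hθ h).unique hh,
    (hθ k).unique hk] at hle
  norm_num at hle

end HexagonTiling

section Sides

open Filter Topology AffineMap

theorem exists_lineMap_eq {ν A B P : Plane} (hν : ν ≠ 0) (hAB : A ≠ B)
    (hB : inner ℝ ν B = inner ℝ ν A) (hP : inner ℝ ν P = inner ℝ ν A) :
    ∃ s : ℝ, lineMap A B s = P := by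
  have hfact : Fact (Module.finrank ℝ Plane = 1 + 1) := ⟨finrank_euclideanSpace_fin⟩
  have hmem {Q : Plane} (hQ : inner ℝ ν Q = inner ℝ ν A) : Q - A ∈ (ℝ ∙ ν)ᗮ := by
    rw [Submodule.mem_orthogonal_singleton_iff_inner_right, inner_sub_right, hQ, sub_self]
  obtain ⟨s, hs⟩ := (finrank_eq_one_iff_of_nonzero' (⟨B - A, hmem hB⟩ : (ℝ ∙ ν)ᗮ)
    (Subtype.coe_ne_coe.1 (sub_ne_zero.2 hAB.symm))).1
    (Submodule.finrank_orthogonal_span_singleton hν) ⟨P - A, hmem hP⟩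
  refine ⟨s, ?_⟩
  rw [lineMap_apply_module', show s • (B - A) = P - A from congrArg Subtype.val hs, sub_add_cancel]

theorem mem_Icc_of_mem_openSegment {a b s t x : ℝ} (hx : x ∈ Ioo a b) (hx' : x ∈ openSegment ℝ s t)
    (ha : a ∉ openSegment ℝ s t) (hb : b ∉ openSegment ℝ s t) : s ∈ Icc a b ∧ t ∈ Icc a b := by
  rcases eq_or_ne s t with rfl | hst
  · rw [openSegment_same, mem_singleton_iff] at hx'
    exact hx' ▸ ⟨Ioo_subset_Icc_self hx, Ioo_subset_Icc_self hx⟩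
  · rw [openSegment_eq_Ioo' hst] at hx' ha hb
    have hmin : a ≤ min s t := not_lt.1 fun h => ha ⟨h, hx.1.trans hx'.2⟩
    have hmax : max s t ≤ b := not_lt.1 fun h => hb ⟨hx'.1.trans hx.2, h⟩
    rw [le_min_iff] at hmin
    rw [max_le_iff] at hmax
    exact ⟨⟨hmin.1, hmax.1⟩, hmin.2, hmax.2⟩

theorem mem_segment_of_collinear {ν A B P Q x : Plane} {c : ℝ} (hν : ν ≠ 0) (hAB : A ≠ B)
    (hA : inner ℝ ν A = c) (hB : inner ℝ ν B = c) (hP : inner ℝ ν P = c) (hQ : inner ℝ ν Q = c)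
    (hx : x ∈ openSegment ℝ A B) (hx' : x ∈ openSegment ℝ P Q) (hA' : A ∉ openSegment ℝ P Q)
    (hB' : B ∉ openSegment ℝ P Q) : P ∈ segment ℝ A B ∧ Q ∈ segment ℝ A B := by
  obtain ⟨s, rfl⟩ := exists_lineMap_eq hν hAB (hB.trans hA.symm) (hP.trans hA.symm)
  obtain ⟨t, rfl⟩ := exists_lineMap_eq hν hAB (hB.trans hA.symm) (hQ.trans hA.symm)
  rw [openSegment_eq_image_lineMap] at hx
  obtain ⟨u, hu, rfl⟩ := hx
  have hmem (v : ℝ) :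
      lineMap A B v ∈ openSegment ℝ (lineMap A B s) (lineMap A B t) ↔ v ∈ openSegment ℝ s t := by
    rw [← image_openSegment, (lineMap_injective ℝ hAB).mem_set_image]
  have h₀ := hmem 0
  have h₁ := hmem 1
  rw [lineMap_apply_zero] at h₀
  rw [lineMap_apply_one] at h₁
  rw [segment_eq_image_lineMap]
  exact (mem_Icc_of_mem_openSegment hu ((hmem u).1 hx') (mt h₀.2 hA') (mt h₁.2 hB')).imp
    (mem_image_of_mem _) (mem_image_of_mem _)

theorem inner_eq_of_mem_openSegment_of_le {ν P Q x : Plane} {c : ℝ} (hx : x ∈ openSegment ℝ P Q)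
    (hxc : inner ℝ ν x = c) (hP : c ≤ inner ℝ ν P) (hQ : c ≤ inner ℝ ν Q) :
    inner ℝ ν P = c ∧ inner ℝ ν Q = c := by
  obtain ⟨a, b, ha, hb, hab, rfl⟩ := hx
  rw [inner_add_right, inner_smul_right, inner_smul_right] at hxc
  have h : a * (inner ℝ ν P - c) + b * (inner ℝ ν Q - c) = 0 := by
    linear_combination hxc - c * hab
  rw [add_eq_zero_iff_of_nonneg (mul_nonneg ha.le (sub_nonneg.2 hP))
    (mul_nonneg hb.le (sub_nonneg.2 hQ)), mul_eq_zero, mul_eq_zero] at h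
  exact ⟨sub_eq_zero.1 (h.1.resolve_left ha.ne'), sub_eq_zero.1 (h.2.resolve_left hb.ne')⟩

theorem dist_le_of_mem_segment {E : Type*} [NormedAddCommGroup E] [NormedSpace ℝ E] {A B P Q : E}
    (hP : P ∈ segment ℝ A B) (hQ : Q ∈ segment ℝ A B) : dist P Q ≤ dist A B := by
  rw [← convexHull_pair] at hP hQ
  rw [← Metric.diam_pair (x := A), ← convexHull_diam]
  exact Metric.dist_le_diam_of_mem (isBounded_convexHull.2 (toFinite _).isBounded) hP hQ

theorem eq_endpoints_of_dist_le {E : Type*} [NormedAddCommGroup E] [NormedSpace ℝ E] {A B P Q : E}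
    (hAB : A ≠ B) (hP : P ∈ segment ℝ A B) (hQ : Q ∈ segment ℝ A B) (h : dist A B ≤ dist P Q) :
    (P = A ∧ Q = B) ∨ (P = B ∧ Q = A) := by
  rw [segment_eq_image_lineMap] at hP hQ
  obtain ⟨s, ⟨hs0, hs1⟩, rfl⟩ := hP
  obtain ⟨t, ⟨ht0, ht1⟩, rfl⟩ := hQ
  rw [dist_lineMap_lineMap, Real.dist_eq] at h
  have hst := (le_mul_iff_one_le_left (dist_pos.2 hAB)).1 h
  rcases le_abs.1 hst with hst | hst
  · obtain rfl : s = 1 := by linarith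
    obtain rfl : t = 0 := by linarith
    exact Or.inr ⟨lineMap_apply_one _ _, lineMap_apply_zero _ _⟩
  · obtain rfl : s = 0 := by linarith
    obtain rfl : t = 1 := by linarith
    exact Or.inl ⟨lineMap_apply_zero _ _, lineMap_apply_one _ _⟩

theorem exists_mem_openSegment_notMem_of_countable {E : Type*} [AddCommGroup E] [Module ℝ E]
    {A B : E} (hAB : A ≠ B) {s : Set E} (hs : s.Countable) : ∃ x ∈ openSegment ℝ A B, x ∉ s := by
  obtain ⟨t, ht, ht'⟩ := ((hs.preimage (lineMap_injective ℝ hAB)).dense_compl ℝ).inter_open_nonempty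
    _ isOpen_Ioo (nonempty_Ioo.2 zero_lt_one)
  exact ⟨_, openSegment_eq_image_lineMap ℝ A B ▸ mem_image_of_mem _ ht, ht'⟩

theorem le_inner_of_disjoint_openPolygon {ι : Type*} [Finite ι] {ν : ι → Pixel} {c : ι → ℤ} {i : ι}
    {p q : Plane} {C : Set Plane} (hp : p ∈ closedPolygon ν c)
    (hi : ∀ k, inner ℝ (emb (ν k)) p = c k ↔ k = i) (hC : Convex ℝ C)
    (hdisj : Disjoint C (openPolygon ν c)) (hpC : p ∈ C) (hqC : q ∈ C) :
    c i ≤ inner ℝ (emb (ν i)) q := by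
  by_contra! hlt
  have hlim : Tendsto (fun t : ℝ => lineMap p q t) (𝓝[>] 0) (𝓝 p) := by
    have := (lineMap_continuous (R := ℝ) (p := p) (q := q)).tendsto 0
    rw [lineMap_apply_zero] at this
    exact this.mono_left nhdsWithin_le_nhds
  obtain ⟨t, hiff, ht⟩ := ((hlim.eventually (eventually_mem_openPolygon_iff hp)).and
    (Ioo_mem_nhdsGT one_pos)).exists
  refine disjoint_left.1 hdisj (hC.lineMap_mem hpC hqC ⟨ht.1.le, ht.2.le⟩) (hiff.2 fun k hk => ?_)
  obtain rfl := (hi k).1 hk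
  rw [lineMap_apply_module', add_sub_cancel_right, inner_smul_right, inner_sub_right, hk]
  exact mul_neg_of_pos_of_neg ht.1 (sub_neg.2 hlt)

theorem image_openSegment_isometryEquiv (g : Plane ≃ᵢ Plane) (x y : Plane) :
    g '' openSegment ℝ x y = openSegment ℝ (g x) (g y) :=
  image_openSegment ℝ g.toRealAffineIsometryEquiv.toAffineEquiv.toAffineMap x y

theorem convex_image_isometryEquiv {C : Set Plane} (hC : Convex ℝ C) (g : Plane ≃ᵢ Plane) :
    Convex ℝ (g '' C) :=
  hC.affine_image g.toRealAffineIsometryEquiv.toAffineEquiv.toAffineMap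

end Sides

section NonTiling

variable {l n : ℤ} {S : Set (Plane ≃ᵢ Plane)}

/-- The squared length of the side of `hexagon l n` joining `hexVertex l n k` to
`hexVertex l n (k + 1)`. -/
def hexSideSq (l n : ℤ) : Fin 6 → ℤ := ![2 * n ^ 2, 2 * l ^ 2, 1, 2 * (n - 1) ^ 2, 1, 2 * l ^ 2]

theorem dist_hexVertex_sq (l n : ℤ) (k : Fin 6) :
    dist (hexVertex l n k) (hexVertex l n (k + 1)) ^ 2 = hexSideSq l n k := by
  rw [EuclideanSpace.dist_eq, Real.sq_sqrt (by positivity), Fin.sum_univ_two, Real.dist_eq,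
    Real.dist_eq, sq_abs, sq_abs]
  fin_cases k <;> simp [hexVertex, emb, hexSideSq] <;> ring

theorem dist_hexVertex_le_iff {i k : Fin 6} :
    dist (hexVertex l n i) (hexVertex l n (i + 1)) ≤
      dist (hexVertex l n k) (hexVertex l n (k + 1)) ↔ hexSideSq l n i ≤ hexSideSq l n k := by
  rw [← sq_le_sq₀ dist_nonneg dist_nonneg, dist_hexVertex_sq, dist_hexVertex_sq, Int.cast_le]

theorem hexVertex_ne_succ (hl : 1 ≤ l) (hn : 2 ≤ n) (k : Fin 6) :
    hexVertex l n k ≠ hexVertex l n (k + 1) :=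
  (convexIndependent_hexVertex hl hn).injective.ne (by decide +revert)

theorem hasSolidAngle_refl_image_hexVertex (hl : 1 ≤ l) (hn : 2 ≤ n) (i : Fin 6) :
    HasSolidAngle (IsometryEquiv.refl Plane '' hexagon l n) (hexVertex l n i) (hexAngle i) :=
  (hasSolidAngle_hexVertex hl hn i).image (.refl _)

theorem IsTiling.exists_across_side (hl : 1 ≤ l) (hn : 2 ≤ n) (hS : IsTiling (hexagon l n) S)
    (hrefl : .refl _ ∈ S) (i : Fin 6) : ∃ g : S, g.1 ≠ .refl _ ∧
      (∀ q ∈ closure (g.1 '' hexagon l n), hexSupport l n i ≤ inner ℝ (emb (hexNormal i)) q) ∧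
      ∃ x ∈ openSegment ℝ (hexVertex l n i) (hexVertex l n (i + 1)),
        ∃ m, x ∈ openSegment ℝ (g.1 (hexVertex l n m)) (g.1 (hexVertex l n (m + 1))) := by
  have hcount : (⋃ g ∈ S, range (g ∘ hexVertex l n)).Countable :=
    (hS.countable isOpen_hexagon (nonempty_hexagon hl hn)).biUnion fun _ _ => countable_range _
  obtain ⟨x, hx, hgeneric⟩ :=
    exists_mem_openSegment_notMem_of_countable (hexVertex_ne_succ hl hn i) hcount
  obtain ⟨g, hg, hxg, hxg'⟩ := hS.exists_ne_of_half hl hn (g := ⟨_, hrefl⟩)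
    ((hasSolidAngle_hexagon_side hl hn hx).image (.refl _))
  have hdisj : Disjoint (closure (g.1 '' hexagon l n)) (hexagon l n) := by
    have h : Disjoint (g.1 '' hexagon l n) (id '' hexagon l n) := hS.disjoint hg
    rw [image_id] at h
    exact h.closure_left isOpen_hexagon
  refine ⟨g, fun h => hg (Subtype.ext h), fun q hq => ?_, x, hx, ?_⟩
  · exact le_inner_of_disjoint_openPolygon (openSegment_hexVertex_subset hl hn i hx)
      (inner_eq_iff_of_mem_openSegment_hexVertex hl hn hx)
      (convex_image_isometryEquiv convex_hexagon g.1).closure hdisj hxg hq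
  · rw [← image_closure] at hxg
    obtain ⟨y, hy, rfl⟩ := hxg
    rcases mem_hexagon_or_eq_hexVertex_or_mem_openSegment hl hn hy with h | ⟨m, rfl⟩ | ⟨m, h⟩
    · exact (hxg' (mem_image_of_mem _ h)).elim
    · exact (hgeneric (mem_iUnion₂.2 ⟨g.1, g.2, mem_range_self m⟩)).elim
    · exact ⟨m, image_openSegment_isometryEquiv g.1 _ _ ▸ mem_image_of_mem _ h⟩

theorem IsTiling.exists_side_subset (hl : 1 ≤ l) (hn : 2 ≤ n) (hS : IsTiling (hexagon l n) S)
    (hrefl : .refl _ ∈ S) {i : Fin 6} (hi : hexAngle i = 3 / 8) (hi' : hexAngle (i + 1) = 3 / 8) :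
    ∃ g : S, g.1 ≠ .refl _ ∧
      (∀ q ∈ closure (g.1 '' hexagon l n), hexSupport l n i ≤ inner ℝ (emb (hexNormal i)) q) ∧
      ∃ m, g.1 (hexVertex l n m) ∈ segment ℝ (hexVertex l n i) (hexVertex l n (i + 1)) ∧
        g.1 (hexVertex l n (m + 1)) ∈ segment ℝ (hexVertex l n i) (hexVertex l n (i + 1)) := by
  obtain ⟨g, hg, hsupp, x, hx, m, hxm⟩ := hS.exists_across_side hl hn hrefl i
  have hvertex (k : Fin 6) :
      hexSupport l n i ≤ inner ℝ (emb (hexNormal i)) (g.1 (hexVertex l n k)) :=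
    hsupp _ (image_closure _ g.1 ▸ mem_image_of_mem _ (hexVertex_mem_closure hl hn k))
  obtain ⟨hP, hQ⟩ := inner_eq_of_mem_openSegment_of_le hxm
    ((inner_eq_iff_of_mem_openSegment_hexVertex hl hn hx i).2 rfl) (hvertex m) (hvertex (m + 1))
  have hcorner {k : Fin 6} (hk : hexAngle k = 3 / 8) : hexVertex l n k ∉
      openSegment ℝ (g.1 (hexVertex l n m)) (g.1 (hexVertex l n (m + 1))) := fun h => by
    rw [← image_openSegment_isometryEquiv] at h
    obtain ⟨y, hy, hyk⟩ := h
    refine hg (congrArg Subtype.val (hS.eq_of_half_of_obtuse hl hn (g := g) (h := ⟨_, hrefl⟩)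
      (hyk ▸ (hasSolidAngle_hexagon_side hl hn hy).image g.1)
      (hk ▸ hasSolidAngle_refl_image_hexVertex hl hn k)))
  exact ⟨g, hg, hsupp, m, mem_segment_of_collinear (emb_ne_zero (hexNormal_ne_zero i))
    (hexVertex_ne_succ hl hn i) ((inner_hexVertex_eq_iff hl hn _ _).2 (Or.inl rfl))
    ((inner_hexVertex_eq_iff hl hn _ _).2 (Or.inr rfl)) hP hQ hx hxm (hcorner hi) (hcorner hi')⟩

theorem eq_two_or_eq_four_of_hexSideSq_le_one (hl : 1 ≤ l) (hn : 2 ≤ n) {k : Fin 6}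
    (hk : hexSideSq l n k ≤ 1) : k = 2 ∨ k = 4 := by
  fin_cases k <;> simp [hexSideSq] at hk ⊢ <;> nlinarith

theorem IsTiling.exists_obtuse_of_short_side (hl : 1 ≤ l) (hn : 2 ≤ n)
    (hS : IsTiling (hexagon l n) S) (hrefl : .refl _ ∈ S) {i : Fin 6} (hi : i = 2 ∨ i = 4) :
    ∃ g : S, g.1 ≠ .refl _ ∧ HasSolidAngle (g.1 '' hexagon l n) (hexVertex l n i) (3 / 8) ∧
      HasSolidAngle (g.1 '' hexagon l n) (hexVertex l n (i + 1)) (3 / 8) := by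
  have hangle {k : Fin 6} (hk : k = 2 ∨ k = 4) : hexAngle k = 3 / 8 ∧ hexAngle (k + 1) = 3 / 8 := by
    rcases hk with rfl | rfl <;> exact ⟨rfl, rfl⟩
  have hside {k : Fin 6} (hk : k = 2 ∨ k = 4) : hexSideSq l n k = 1 := by
    rcases hk with rfl | rfl <;> rfl
  obtain ⟨g, hg, -, m, hP, hQ⟩ :=
    hS.exists_side_subset hl hn hrefl (hangle hi).1 (hangle hi).2
  have hle := dist_le_of_mem_segment hP hQ
  rw [g.1.dist_eq, dist_hexVertex_le_iff, hside hi] at hle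
  have hm := eq_two_or_eq_four_of_hexSideSq_le_one hl hn hle
  have hPangle := (hasSolidAngle_hexVertex hl hn m).image g.1
  have hQangle := (hasSolidAngle_hexVertex hl hn (m + 1)).image g.1
  rw [(hangle hm).1] at hPangle
  rw [(hangle hm).2] at hQangle
  refine ⟨g, hg, ?_⟩
  have hge : dist (hexVertex l n i) (hexVertex l n (i + 1)) ≤
      dist (g.1 (hexVertex l n m)) (g.1 (hexVertex l n (m + 1))) := by
    rw [g.1.dist_eq, dist_hexVertex_le_iff, hside hi, hside hm]
  rcases eq_endpoints_of_dist_le (hexVertex_ne_succ hl hn i) hP hQ hge with ⟨h, h'⟩ | ⟨h, h'⟩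
  · exact ⟨h ▸ hPangle, h' ▸ hQangle⟩
  · exact ⟨h' ▸ hQangle, h ▸ hPangle⟩

theorem IsTiling.not_obtuse_of_le_inner (hl : 1 ≤ l) (hn : 2 ≤ n)
    (hS : IsTiling (hexagon l n) S) (hrefl : .refl _ ∈ S) {g h : S} {i j k : Fin 6}
    (hg : g.1 ≠ .refl _) (hh : h.1 ≠ .refl _)
    (hsupp : ∀ q ∈ closure (h.1 '' hexagon l n),
      hexSupport l n i ≤ inner ℝ (emb (hexNormal i)) q)
    (hgj : HasSolidAngle (g.1 '' hexagon l n) (hexVertex l n j) (3 / 8))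
    (hgk : HasSolidAngle (g.1 '' hexagon l n) (hexVertex l n k) (3 / 8))
    (hj : hexAngle j = 3 / 8) (hk : k ≠ i) (hk' : k ≠ i + 1) :
    ¬HasSolidAngle (h.1 '' hexagon l n) (hexVertex l n j) (3 / 8) := by
  have hgh : g ≠ h := by
    rintro rfl
    have hmem := hgk.mem_closure (by norm_num)
    exact not_or_intro hk hk' <| (inner_hexVertex_eq_iff hl hn i k).1 <|
      (inner_hexVertex_le hl hn i k).antisymm (hsupp _ hmem)
  exact hS.not_three_obtuse hl hn (g := ⟨_, hrefl⟩) (fun h => hg (congrArg Subtype.val h).symm)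
    (fun h => hh (congrArg Subtype.val h).symm) hgh
    (hj ▸ hasSolidAngle_refl_image_hexVertex hl hn j) hgj

theorem not_isTiling_hexagon (hl : 1 ≤ l) (hn : 2 ≤ n) (hrefl : .refl _ ∈ S) :
    ¬IsTiling (hexagon l n) S := by
  intro hS
  obtain ⟨g, hg, hg₂, hg₃⟩ := hS.exists_obtuse_of_short_side hl hn hrefl (Or.inl rfl)
  obtain ⟨g', hg', hg₄, hg₅⟩ := hS.exists_obtuse_of_short_side hl hn hrefl (Or.inr rfl)
  obtain ⟨h, hh, hsupp, m, hP, hQ⟩ := hS.exists_side_subset hl hn hrefl (i := 3) rfl rfl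
  have hright {k : Fin 6}
      (hk : h.1 (hexVertex l n k) ∈ segment ℝ (hexVertex l n 3) (hexVertex l n (3 + 1))) :
      hexAngle k ≠ 3 / 8 := fun hobtuse => by
    have hangle := hobtuse ▸ (hasSolidAngle_hexVertex hl hn k).image h.1
    rw [← insert_endpoints_openSegment] at hk
    rcases hk with hk | hk | hk
    · exact hS.not_obtuse_of_le_inner hl hn hrefl hg hh hsupp hg₃ hg₂ rfl (by decide) (by decide)
        (hk ▸ hangle)
    · exact hS.not_obtuse_of_le_inner hl hn hrefl hg' hh hsupp hg₄ hg₅ rfl (by decide) (by decide)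
        (hk ▸ hangle)
    · exact hh (congrArg Subtype.val (hS.eq_of_half_of_obtuse hl hn (g := ⟨_, hrefl⟩)
        ((hasSolidAngle_hexagon_side hl hn hk).image (.refl _)) hangle)).symm
  obtain rfl : m = 0 := by
    have h₁ := hright hP
    have h₂ := hright hQ
    fin_cases m <;> simp [hexAngle] at h₁ h₂ ⊢
  have hle := dist_le_of_mem_segment hP hQ
  rw [h.1.dist_eq, dist_hexVertex_le_iff] at hle
  simp only [hexSideSq, Matrix.cons_val] at hle
  nlinarith

theorem not_tilesPlane_hexagon (hl : 1 ≤ l) (hn : 2 ≤ n) : ¬TilesPlane (hexagon l n) := fun h =>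
  let ⟨_, hrefl, hS⟩ := exists_isTiling_refl_mem h
  not_isTiling_hexagon hl hn hrefl hS

end NonTiling

end DigitalPlane

theorem lemma7p2_general :
    (∀ n j : ℕ, 1 ≤ j → j ≤ n →
      TilesByLattice (polygonalTile (spiral (s₁ n + j)))
        (columnLattice !![(n : ℤ), n + j; -n - 1, n - j])) ∧
    (∀ n j : ℕ, 1 ≤ j → j ≤ n →
      Disjoint (polygonalTile (spiral (s₃ (n - 1) + j)))
        (halfTurn (n, n) (polygonalTile (spiral (s₃ (n - 1) + j)))) ∧
      TilesByLattice (polygonalTile (spiral (s₃ (n - 1) + j)) ∪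
          halfTurn (n, n) (polygonalTile (spiral (s₃ (n - 1) + j))))
        (columnLattice !![(n : ℤ) - 1, 2 * n - 1 + j; -n - 1, 2 * n - 1 - j])) ∧
    (∀ l n : ℕ, 1 ≤ l → 2 ≤ n →
      IsOpenConvexHexagon (polygonalTile (sieben l n)) ∧
      ¬ TilesPlane (polygonalTile (sieben l n))) := by
  refine ⟨fun n j hj hjn => ?_, fun n j hj hjn => ?_, fun l n hl hn => ?_⟩
  · rw [spiral_s₁_add (by omega) hjn, polygonalTile_northEastStage (by omega) (by omega)]
    exact tilesByLattice_northEastTile (by omega) (by omega)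
  · rw [spiral_s₃_add (by omega), Nat.cast_sub (by omega), Nat.cast_one,
      polygonalTile_southWestStage (by omega) (by omega)]
    exact ⟨disjoint_southWestTile_halfTurn,
      tilesByLattice_southWestTile_union_halfTurn (by omega) (by omega)⟩
  · rw [polygonalTile_sieben hl hn]
    exact ⟨isOpenConvexHexagon_hexagon (by omega) (by omega),
      not_tilesPlane_hexagon (by omega) (by omega)⟩

theorem lemma7p2 :
    (∀ n j : ℕ, 1 ≤ j → j ≤ n →
      TilesByLattice (polygonalTile (spiral (s₁ n + j)))
        (columnLattice !![(n : ℤ), n + j; -n - 1, n - j])) ∧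
    (∀ n j : ℕ, 1 ≤ j → j ≤ n →
      Disjoint (polygonalTile (spiral (s₃ (n - 1) + j)))
        (halfTurn (n, n) (polygonalTile (spiral (s₃ (n - 1) + j)))) ∧
      TilesByLattice (polygonalTile (spiral (s₃ (n - 1) + j)) ∪
          halfTurn (n, n) (polygonalTile (spiral (s₃ (n - 1) + j))))
        (columnLattice !![(n : ℤ) - 1, 2 * n - 1 + j; -n - 1, 2 * n - 1 - j])) ∧
    (∀ l n : ℕ, 1 ≤ l → l ≤ n → 2 ≤ n →
      IsOpenConvexHexagon (polygonalTile (sieben l n)) ∧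
      ¬ TilesPlane (polygonalTile (sieben l n))) :=
  ⟨lemma7p2_general.1, lemma7p2_general.2.1,
    fun l n hl _ hn => lemma7p2_general.2.2 l n hl hn⟩
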